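/- **Conventions.** Let $K$ be a field of characteristic $0$ and let $A=A^0\oplus A^1$ be a commutative superalgebra over $K$, i.e. an associative, not necessarily unital, $\mathbb Z/2$-graded $K$-algebra with $ab=(-1)^{|a||b|}ba$ for homogeneous $a,b$. For $n\ge 0$ let $D_n(A)$ be the space of $K$-multilinear maps $\omega\colon A^{n+1}\to A$ which are supersymmetric, that is, $\omega(\ldots,a_{i+1},a_i,\ldots)=(-1)^{|a_i||a_{i+1}|}\omega(\ldots,a_i,a_{i+1},\ldots)$; put $D(A)=\prod_{n\ge 0}D_n(A)$. Let $S(p,q)$ be the set of $(p,q)$-shuffles, i.e. permutations that are increasing on the first $p$ and on the last $q$ indices. For homogeneous elements $a_1,a_2,\ldots$ and a permutation $\sigma$ let $\epsilon(\sigma)=(-1)^\alpha$ be the Koszul sign, where $\alpha$ is the number of pairs $i<j$ such that $\sigma(i)>\sigma(j)$ and $a_{\sigma(i)},a_{\sigma(j)}$ are both odd. For $\omega\in D_i(A)$ and $\eta\in D_j(A)$ let $$(\omega\barwedge\eta)(a_0,\ldots,a_{i+j})=\sum_{\sigma\in S(j+1,i)}\epsilon(\sigma)\,\omega\bigl(\eta(a_{\sigma(0)},\ldots,a_{\sigma(j)}),a_{\sigma(j+1)},\ldots,a_{\sigma(i+j)}\bigr),$$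 and let $[\omega,\eta]=\omega\barwedge\eta-(-1)^{|\omega||\eta|}\eta\barwedge\omega\in D_{i+j}(A)$ be the Nijenhuis--Richardson bracket, extended to $D(A)$ by $[\omega,\eta]_n=\sum_{i=0}^n[\omega_i,\eta_{n-i}]$. Let $\mu_n\in D_n(A)$ be $\mu_n(a_0,\ldots,a_n)=a_0a_1\cdots a_n$ and let $\rho_n=[\mu_n,-]\colon D(A)\to D(A)$. For a $K$-linear map $f\colon A\to A$ (an element of $D_0(A)$) and $n\ge1$, the higher antibracket $\Phi^n_f\in D_{n-1}(A)$ is given on homogeneous elements by $$\Phi^n_f(a_1,\ldots,a_n)=\sum_{k=1}^n(-1)^{n-k}\sum_{\sigma\in S(k,n-k)}\epsilon(\sigma)\,f(a_{\sigma(1)}\cdots a_{\sigma(k)})\,a_{\sigma(k+1)}\cdots a_{\sigma(n)}.$$ **Theorem.** For every integer $n>0$ there is a sequence $c^n_1,\ldots,c^n_n$ of rational numbers such that, for every field $K$ of characteristic $0$, every commutative superalgebra $A$ over $K$ and every $K$-linear map $f\colon A\to A$, $$\Phi^{n+1}_f=\bigl(c^n_1\rho_1^n+c^n_2\rho_1^{n-2}\rho_2+c^n_3\rho_1^{n-3}\rho_3+\cdots+c^n_n\rho_n\bigr)f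 .$$ This sequence is unique; indeed, for each single field $K$ of characteristic $0$, it is the only sequence of $n$ rational numbers for which the formula holds for all commutative superalgebras $A$ over $K$ and all $K$-linear maps $f\colon A\to A$. -/

import Mathlib

namespace HigherAntibrackets

/-- The sign `(-1)^{pq}` attached to two parities `p, q ∈ ℤ/2`. -/
def sgn (K : Type*) [Field K] (p q : ZMod 2) : K := (-1) ^ (p.val * q.val)

/-- A commutative superalgebra `A = A⁰ ⊕ A¹` over `K`, not necessarily with a unit. The associative
bilinear product is that of `[NonUnitalRing A]`, `[IsScalarTower K A A]`, `[SMulCommClass K A A]`,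
and the decomposition into the even part `𝒜 0` and the odd part `𝒜 1` is
`[DirectSum.Decomposition 𝒜]`. -/
class CommSuperalgebra {K A : Type*} [Field K] [NonUnitalRing A] [Module K A]
    [IsScalarTower K A A] [SMulCommClass K A A]
    (𝒜 : ZMod 2 → Submodule K A) [DirectSum.Decomposition 𝒜] : Prop where
  mul_mem : ∀ {p q : ZMod 2} {a b : A}, a ∈ 𝒜 p → b ∈ 𝒜 q → a * b ∈ 𝒜 (p + q)
  mul_comm : ∀ {p q : ZMod 2} {a b : A}, a ∈ 𝒜 p → b ∈ 𝒜 q → a * b = sgn K p q • (b * a)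

/-- The Koszul sign `ε(σ)` of a permutation acting on homogeneous elements `a₁, …, a_N` of parities
`par 1, …, par N`: it is `(-1)^α`, with `α` the number of pairs `i < j` such that `σ(i) > σ(j)` and
`a_{σ(i)}`, `a_{σ(j)}` are both odd. -/
def koszulSign (K : Type*) [Field K] {N : ℕ} (par : Fin N → ZMod 2) (σ : Equiv.Perm (Fin N)) : K :=
  (-1) ^ (Finset.univ.filter fun x : Fin N × Fin N =>
    x.1 < x.2 ∧ σ x.2 < σ x.1 ∧ par (σ x.1) = 1 ∧ par (σ x.2) = 1).card

/-- The shuffles of type `(p, N - p)`: the permutations of `N` letters that are increasing on the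
first `p` positions and on the last `N - p` positions. -/
def shuffles (N p : ℕ) : Finset (Equiv.Perm (Fin N)) :=
  Finset.univ.filter fun σ =>
    (∀ i j : Fin N, i < j → j.val < p → σ i < σ j) ∧
    (∀ i j : Fin N, i < j → p ≤ i.val → σ i < σ j)

lemma sgn_comm (K : Type*) [Field K] (p q : ZMod 2) : sgn K p q = sgn K q p := by
  simp [sgn, mul_comm]

lemma sgn_mul_self (K : Type*) [Field K] (p q : ZMod 2) : sgn K p q * sgn K p q = 1 := by
  rw [sgn, ← mul_pow]; simp

lemma sgn_eq_ite (K : Type*) [Field K] (p q : ZMod 2) :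
    sgn K p q = if p = 1 ∧ q = 1 then -1 else 1 := by
  have h : ∀ p q : ZMod 2, (p = 1 ∧ q = 1 → p.val * q.val = 1) ∧
      (¬ (p = 1 ∧ q = 1) → p.val * q.val = 0) := by decide
  split_ifs with hpq
  · simp [sgn, (h p q).1 hpq]
  · simp [sgn, (h p q).2 hpq]

section Koszul

variable {K : Type*} [Field K] {N : ℕ}

lemma neg_one_pow_card {ι : Type*} (s : Finset ι) (P : ι → Prop) [DecidablePred P] :
    (-1 : K) ^ (s.filter P).card = ∏ x ∈ s, if P x then -1 else 1 := by
  rw [Finset.prod_ite]; simp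

lemma koszulSign_eq_inv (par : Fin N → ZMod 2) (σ : Equiv.Perm (Fin N)) :
    koszulSign K par σ = (-1) ^ (Finset.univ.filter fun x : Fin N × Fin N =>
      x.1 < x.2 ∧ σ.symm x.2 < σ.symm x.1 ∧ par x.1 = 1 ∧ par x.2 = 1).card := by
  unfold koszulSign
  congr 1
  refine Finset.card_bij' (fun x _ => (σ x.2, σ x.1)) (fun x _ => (σ.symm x.2, σ.symm x.1))
    ?_ ?_ ?_ ?_ <;> simp <;> tauto

/-- An adjacent transposition preserves the order of all other pairs. -/
lemma swap_lt_iff {a b : Fin N} (hab : a.val + 1 = b.val) (x y : Fin N)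
    (h1 : ¬ (x = a ∧ y = b)) (h2 : ¬ (x = b ∧ y = a)) :
    Equiv.swap a b x < Equiv.swap a b y ↔ x < y := by
  simp only [Equiv.swap_apply_def, Fin.ext_iff, Fin.lt_def] at *
  split_ifs <;> omega

/-- Composing with an adjacent transposition creates or removes exactly one inversion. -/
lemma inversions_swap (τ : Equiv.Perm (Fin N)) (W : Fin N → Prop) [DecidablePred W] {a b : Fin N}
    (hab : a.val + 1 = b.val) :
    (-1 : K) ^ (Finset.univ.filter fun x : Fin N × Fin N => x.1 < x.2 ∧
        Equiv.swap a b (τ x.2) < Equiv.swap a b (τ x.1) ∧ W x.1 ∧ W x.2).card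
      = (if W (τ.symm a) ∧ W (τ.symm b) then -1 else 1) *
        (-1 : K) ^ (Finset.univ.filter fun x : Fin N × Fin N => x.1 < x.2 ∧
          τ x.2 < τ x.1 ∧ W x.1 ∧ W x.2).card := by
  have hlt : a < b := by rw [Fin.lt_def]; omega
  have hne : τ.symm a ≠ τ.symm b := fun h => hlt.ne (τ.symm.injective h)
  rw [neg_one_pow_card, neg_one_pow_card]
  obtain ⟨x₀, hx₀⟩ : ∃ x₀ : Fin N × Fin N, x₀.1 < x₀.2 ∧
      ((x₀.1 = τ.symm a ∧ x₀.2 = τ.symm b) ∨ (x₀.1 = τ.symm b ∧ x₀.2 = τ.symm a)) := by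
    rcases lt_or_gt_of_ne hne with h | h
    · exact ⟨(τ.symm a, τ.symm b), h, Or.inl ⟨rfl, rfl⟩⟩
    · exact ⟨(τ.symm b, τ.symm a), h, Or.inr ⟨rfl, rfl⟩⟩
  have key : (if W (τ.symm a) ∧ W (τ.symm b) then (-1 : K) else 1) =
      ∏ x : Fin N × Fin N,
        if x = x₀ then (if W (τ.symm a) ∧ W (τ.symm b) then (-1 : K) else 1) else 1 := by
    simp
  rw [key, ← Finset.prod_mul_distrib]
  refine Finset.prod_congr rfl fun x _ => ?_
  by_cases hx : x = x₀
  · subst hx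
    obtain ⟨h1, ⟨h2, h3⟩ | ⟨h2, h3⟩⟩ := hx₀
    · simp [h2, h3, hlt, hlt.not_gt, h2 ▸ h3 ▸ h1, and_comm]
    · have h1' := h1
      rw [h2, h3] at h1'
      by_cases hW : W (τ.symm a) ∧ W (τ.symm b)
      · simp [h2, h3, hlt, hlt.not_gt, h1', hW]
      · simp [h2, h3, hlt, hlt.not_gt, h1', hW]
        exact fun hb ha => absurd ⟨ha, hb⟩ hW
  · rw [if_neg hx, one_mul]
    by_cases h12 : x.1 < x.2
    · have hsw : Equiv.swap a b (τ x.2) < Equiv.swap a b (τ x.1) ↔ τ x.2 < τ x.1 := by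
        refine swap_lt_iff hab _ _ ?_ ?_
        · rintro ⟨h1, h2⟩
          have e1 : x.2 = τ.symm a := by rw [← h1]; simp
          have e2 : x.1 = τ.symm b := by rw [← h2]; simp
          obtain ⟨h3, ⟨h4, h5⟩ | ⟨h4, h5⟩⟩ := hx₀
          · rw [e1, e2, ← h4, ← h5] at h12
            exact absurd h12 h3.not_gt
          · exact hx (Prod.ext (e2.trans h4.symm) (e1.trans h5.symm))
        · rintro ⟨h1, h2⟩
          have e1 : x.2 = τ.symm b := by rw [← h1]; simp
          have e2 : x.1 = τ.symm a := by rw [← h2]; simp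
          obtain ⟨h3, ⟨h4, h5⟩ | ⟨h4, h5⟩⟩ := hx₀
          · exact hx (Prod.ext (e2.trans h4.symm) (e1.trans h5.symm))
          · rw [e1, e2, ← h4, ← h5] at h12
            exact absurd h12 h3.not_gt
      simp only [hsw]
    · simp [h12]

lemma koszulSign_swap_mul (par : Fin N → ZMod 2) (σ : Equiv.Perm (Fin N)) {a b : Fin N}
    (hab : a.val + 1 = b.val) :
    koszulSign K (par ∘ Equiv.swap a b) σ
      = sgn K (par a) (par b) * koszulSign K par (Equiv.swap a b * σ) := by
  have := inversions_swap (K := K) σ (fun i => par (Equiv.swap a b (σ i)) = 1) hab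
  have hs : sgn K (par a) (par b) = if par (Equiv.swap a b (σ (σ.symm a))) = 1 ∧
      par (Equiv.swap a b (σ (σ.symm b))) = 1 then -1 else 1 := by
    rw [sgn_comm, sgn_eq_ite]
    simp
  refine Eq.trans ?_ (congrArg (sgn K (par a) (par b) * ·) this).symm
  rw [← hs, ← mul_assoc, sgn_mul_self, one_mul]
  rfl

lemma koszulSign_mul_swap (par : Fin N → ZMod 2) (σ : Equiv.Perm (Fin N)) {a b : Fin N}
    (hab : a.val + 1 = b.val) :
    koszulSign K par (σ * Equiv.swap a b)
      = sgn K (par (σ a)) (par (σ b)) * koszulSign K par σ := by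
  have := inversions_swap (K := K) σ.symm (fun i => par i = 1) hab
  rw [koszulSign_eq_inv, koszulSign_eq_inv, sgn_eq_ite]
  exact this

end Koszul

section Multilinear

variable {K A : Type*} [Field K] [NonUnitalRing A] [Module K A]

/-- `F(…, b, …, a, …) = (-1)^{|a||b|} F(…, a, …, b, …)`, the exchanged entries standing at the
places `x` and `y`. -/
def SupersymmetricAt (𝒜 : ZMod 2 → Submodule K A) {N : ℕ}
    (F : MultilinearMap K (fun _ : Fin N => A) A) (x y : Fin N) : Prop :=
  ∀ (p q : ZMod 2) (v : Fin N → A), v x ∈ 𝒜 p → v y ∈ 𝒜 q →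
    F (fun i => v (Equiv.swap x y i)) = sgn K p q • F v

/-- `D_n(A) = Hom^*(A^{⊙ n+1}, A)`, the supersymmetric multilinear maps in `n + 1` variables. -/
def SymMap (𝒜 : ZMod 2 → Submodule K A) (n : ℕ) :
    Submodule K (MultilinearMap K (fun _ : Fin (n + 1) => A) A) where
  carrier := {F | ∀ x y : Fin (n + 1), x.val + 1 = y.val → SupersymmetricAt 𝒜 F x y}
  add_mem' := by
    intro F G hF hG x y hxy p q v hx hy
    simp [hF x y hxy p q v hx hy, hG x y hxy p q v hx hy]
  zero_mem' := by
    intro x y hxy p q v hx hy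
    simp
  smul_mem' := by
    intro c F hF x y hxy p q v hx hy
    simp [hF x y hxy p q v hx hy, smul_comm c]

/-- `D(A) = ∏_{n ≥ 0} D_n(A)`. -/
abbrev D (𝒜 : ZMod 2 → Submodule K A) : Type _ := (n : ℕ) → SymMap 𝒜 n

section Homogeneous

variable (𝒜 : ZMod 2 → Submodule K A) [DirectSum.Decomposition 𝒜]

/-- The projection of `A` onto its homogeneous part of parity `p`. -/
def proj (p : ZMod 2) : A →ₗ[K] A :=
  (𝒜 p).subtype ∘ₗ DirectSum.component K (ZMod 2) (fun i => 𝒜 i) p ∘ₗ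
    (DirectSum.decomposeLinearEquiv 𝒜).toLinearMap

lemma proj_mem (p : ZMod 2) (a : A) : proj 𝒜 p a ∈ 𝒜 p := by simp [proj]

lemma proj_same {p : ZMod 2} {a : A} (h : a ∈ 𝒜 p) : proj 𝒜 p a = a :=
  DirectSum.decompose_of_mem_same 𝒜 h

lemma proj_ne {p q : ZMod 2} {a : A} (h : a ∈ 𝒜 p) (hpq : p ≠ q) : proj 𝒜 q a = 0 :=
  DirectSum.decompose_of_mem_ne 𝒜 h hpq

/-- The multilinear map whose value on homogeneous elements of parities `ε` is given by `G ε`. -/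
def homogExt {N : ℕ} (G : (Fin N → ZMod 2) → MultilinearMap K (fun _ : Fin N => A) A) :
    MultilinearMap K (fun _ : Fin N => A) A :=
  ∑ ε : Fin N → ZMod 2, (G ε).compLinearMap fun i => proj 𝒜 (ε i)

lemma homogExt_apply {N : ℕ}
    (G : (Fin N → ZMod 2) → MultilinearMap K (fun _ : Fin N => A) A)
    (ε : Fin N → ZMod 2) (v : Fin N → A) (hv : ∀ i, v i ∈ 𝒜 (ε i)) :
    homogExt 𝒜 G v = G ε v := by
  rw [homogExt, sum_apply, Finset.sum_eq_single ε]
  · simp [proj_same 𝒜 (hv _)]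
  · intro ε' _ hne
    obtain ⟨i, hi⟩ := Function.ne_iff.1 hne
    rw [MultilinearMap.compLinearMap_apply]
    exact (G ε').map_coord_zero i (proj_ne 𝒜 (hv i) (Ne.symm hi))
  · simp

lemma homogExt_supersymmetricAt {N : ℕ}
    (G : (Fin N → ZMod 2) → MultilinearMap K (fun _ : Fin N => A) A) (x y : Fin N)
    (hG : ∀ (ε : Fin N → ZMod 2) (v : Fin N → A), (∀ i, v i ∈ 𝒜 (ε i)) →
      G (ε ∘ Equiv.swap x y) (fun i => v (Equiv.swap x y i)) = sgn K (ε x) (ε y) • G ε v) :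
    SupersymmetricAt 𝒜 (homogExt 𝒜 G) x y := by
  intro p q v hx hy
  simp only [homogExt, sum_apply, MultilinearMap.compLinearMap_apply,
    Finset.smul_sum]
  refine Fintype.sum_equiv (Equiv.arrowCongr (Equiv.swap x y) (Equiv.refl (ZMod 2))) _ _ fun ε => ?_
  set ε' : Fin N → ZMod 2 := ε ∘ Equiv.swap x y with hε'
  have e1 : (Equiv.arrowCongr (Equiv.swap x y) (Equiv.refl (ZMod 2))) ε = ε' := by
    funext i
    simp [hε', Equiv.arrowCongr]
  have e2 : ε = ε' ∘ Equiv.swap x y := by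
    funext i
    simp [hε']
  rw [e1]
  have e3 := hG ε' (fun i => proj 𝒜 (ε' i) (v i)) fun i => proj_mem 𝒜 _ _
  rw [← e2] at e3
  have e4 : (fun i => proj 𝒜 (ε i) (v (Equiv.swap x y i))) =
      fun i => proj 𝒜 (ε' (Equiv.swap x y i)) (v (Equiv.swap x y i)) := by
    funext i
    rw [e2]
    rfl
  rw [e4, e3]
  by_cases hp : p = ε' x
  · by_cases hq : q = ε' y
    · rw [hp, hq]
    · rw [(G ε').map_coord_zero y (proj_ne 𝒜 hy hq), smul_zero, smul_zero]
  · rw [(G ε').map_coord_zero x (proj_ne 𝒜 hx hp), smul_zero, smul_zero]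

/-- The component of parity `p` of a multilinear map `F`: on homogeneous elements it is the part of
parity `p + |a₀| + … + |a_n|` of `F(a₀, …, a_n)`. -/
def parityPart (p : ZMod 2) {n : ℕ} (F : SymMap 𝒜 n) : SymMap 𝒜 n :=
  ⟨homogExt 𝒜 fun ε => (proj 𝒜 (p + ∑ i, ε i)).compMultilinearMap F.1, by
    intro x y hxy
    refine homogExt_supersymmetricAt 𝒜 _ x y fun ε v hv => ?_
    have hsum : ∑ i, ε (Equiv.swap x y i) = ∑ i, ε i := Equiv.sum_comp (Equiv.swap x y) ε
    simp [hsum, F.2 x y hxy _ _ v (hv x) (hv y)]⟩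

/-- The sum over shuffles: on homogeneous elements, it is
`(a₁, …, a_N) ↦ ∑_{σ ∈ S(p, N-p)} ε(σ) F(a_{σ(1)}, …, a_{σ(N)})`. -/
def shuffleSum {N : ℕ} (p : ℕ) (F : MultilinearMap K (fun _ : Fin N => A) A) :
    MultilinearMap K (fun _ : Fin N => A) A :=
  homogExt 𝒜 fun ε => ∑ σ ∈ shuffles N p, koszulSign K ε σ • F.domDomCongr σ

lemma shuffleSum_apply {N : ℕ} (p : ℕ) (F : MultilinearMap K (fun _ : Fin N => A) A)
    (ε : Fin N → ZMod 2) (v : Fin N → A) (hv : ∀ i, v i ∈ 𝒜 (ε i)) :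
    shuffleSum 𝒜 p F v = ∑ σ ∈ shuffles N p, koszulSign K ε σ • F (fun i => v (σ i)) := by
  rw [shuffleSum, homogExt_apply 𝒜 _ ε v hv]; simp

lemma shuffleSum_mem {n : ℕ} (p : ℕ) (F : MultilinearMap K (fun _ : Fin (n + 1) => A) A)
    (hF : ∀ x y : Fin (n + 1), x.val + 1 = y.val → y.val ≠ p → SupersymmetricAt 𝒜 F x y) :
    shuffleSum 𝒜 p F ∈ SymMap 𝒜 n := by
  intro a b hab
  refine homogExt_supersymmetricAt 𝒜 _ a b fun ε v hv => ?_
  have hlt : a < b := by rw [Fin.lt_def]; omega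
  simp only [sum_apply, smul_apply, MultilinearMap.domDomCongr_apply,
    Finset.smul_sum]
  set s := Equiv.swap a b with hs
  have hss : ∀ σ : Equiv.Perm (Fin (n + 1)), s * (s * σ) = σ := fun σ => by
    rw [← mul_assoc, hs, Equiv.swap_mul_self, one_mul]
  have hinv : ∀ σ : Equiv.Perm (Fin (n + 1)),
      ((s * σ).symm a = σ.symm b) ∧ ((s * σ).symm b = σ.symm a) := fun σ =>
    ⟨by rw [Equiv.symm_apply_eq]; simp [hs], by rw [Equiv.symm_apply_eq]; simp [hs]⟩
  let B : Equiv.Perm (Fin (n + 1)) → Prop := fun σ => ((σ.symm a).val < p ↔ (σ.symm b).val < p)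
  have hB : ∀ σ, B (s * σ) ↔ B σ := fun σ => by
    simp only [B, (hinv σ).1, (hinv σ).2]; tauto
  classical
  let φ : Equiv.Perm (Fin (n + 1)) → Equiv.Perm (Fin (n + 1)) := fun σ => if B σ then σ else s * σ
  have hφ : ∀ σ, φ (φ σ) = σ := fun σ => by
    by_cases h : B σ
    · simp [φ, h]
    · simp [φ, h, hB, hss]
  have hmem : ∀ σ ∈ shuffles (n + 1) p, φ σ ∈ shuffles (n + 1) p := fun σ hσ => by
    by_cases h : B σ
    · simpa [φ, h] using hσ
    · simp only [φ, if_neg h]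
      simp only [shuffles, Finset.mem_filter, Finset.mem_univ, true_and] at hσ ⊢
      refine ⟨fun i j hij hj => ?_, fun i j hij hi => ?_⟩
      · refine (swap_lt_iff hab _ _ ?_ ?_).2 (hσ.1 i j hij hj)
        all_goals
          rintro ⟨h1, h2⟩
          apply h
          have e1 := σ.eq_symm_apply.2 h1
          have e2 := σ.eq_symm_apply.2 h2
          have : i.val < j.val := hij
          simp only [B, ← e1, ← e2]
          omega
      · refine (swap_lt_iff hab _ _ ?_ ?_).2 (hσ.2 i j hij hi)
        all_goals
          rintro ⟨h1, h2⟩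
          apply h
          have e1 := σ.eq_symm_apply.2 h1
          have e2 := σ.eq_symm_apply.2 h2
          have : i.val < j.val := hij
          simp only [B, ← e1, ← e2]
          omega
  refine Finset.sum_nbij' φ φ hmem hmem (fun σ _ => hφ σ) (fun σ _ => hφ σ) fun σ hσ => ?_
  rw [koszulSign_swap_mul ε σ hab, mul_smul]
  congr 1
  by_cases h : B σ
  · simp only [φ, if_pos h]
    set x := σ.symm a with hx
    set y := σ.symm b with hy
    have hxa : σ x = a := by simp [hx]
    have hyb : σ y = b := by simp [hy]
    simp only [shuffles, Finset.mem_filter, Finset.mem_univ, true_and] at hσ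
    have hB' : x.val < p ↔ y.val < p := h
    have hmono : ∀ i j : Fin (n + 1), i < j → (i.val < p ↔ j.val < p) → σ i < σ j :=
      fun i j hij hp => by
        by_cases hj : j.val < p
        · exact hσ.1 i j hij hj
        · exact hσ.2 i j hij (by omega)
    have hxy : x < y := by
      rcases lt_trichotomy x y with h1 | h1 | h1
      · exact h1
      · rw [← hxa, ← hyb, h1] at hlt
        exact absurd hlt (lt_irrefl _)
      · have := hmono y x h1 hB'.symm
        rw [hxa, hyb] at this
        exact absurd this hlt.not_gt
    have hadj : x.val + 1 = y.val := by
      by_contra hne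
      have hxy' : x.val < y.val := hxy
      let m : Fin (n + 1) := ⟨x.val + 1, by omega⟩
      have h1 : σ x < σ m := hmono x m (by simp [m, Fin.lt_def]) (by simp only [m]; omega)
      have h2 : σ m < σ y := hmono m y (by simp only [m, Fin.lt_def]; omega)
        (by simp only [m]; omega)
      rw [hxa, Fin.lt_def] at h1
      rw [hyb, Fin.lt_def] at h2
      omega
    have hcomm : s * σ = σ * Equiv.swap x y := by
      rw [Equiv.mul_swap_eq_swap_mul, hxa, hyb]
    have hne : y.val ≠ p := by omega
    have hF' := hF x y hadj hne (ε a) (ε b) (fun i => v (σ i)) (by rw [hxa]; exact hv a)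
      (by rw [hyb]; exact hv b)
    have hvs : (fun i => v (s (σ i))) = fun i => v (σ (Equiv.swap x y i)) := by
      funext i
      exact congrArg v (DFunLike.congr_fun hcomm i)
    rw [hcomm, koszulSign_mul_swap ε σ hadj, hxa, hyb, hvs, hF', smul_smul, mul_right_comm,
      sgn_mul_self, one_mul]
  · simp only [φ, if_neg h]
    rfl

end Homogeneous

/-- The splitting of `n + 1` places into the first `j + 1` and the last `i`. -/
def split {i j n : ℕ} (h : i + j = n) : Fin (j + 1) ⊕ Fin i ≃ Fin (n + 1) :=
  finSumFinEquiv.trans (finCongr (by omega))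

/-- The multilinear map `(a₀, …, a_n) ↦ f(g(a₀, …, a_j), a_{j+1}, …, a_n)`, `n = i + j`. -/
def insertFirst {i j n : ℕ} (f : MultilinearMap K (fun _ : Fin (i + 1) => A) A)
    (g : MultilinearMap K (fun _ : Fin (j + 1) => A) A) (h : i + j = n) :
    MultilinearMap K (fun _ : Fin (n + 1) => A) A :=
  (MultilinearMap.uncurrySum (N := fun _ : Fin (j + 1) ⊕ Fin i => A)
    (f.curryLeft.compMultilinearMap g)).domDomCongr (split h)

lemma insertFirst_apply {i j n : ℕ} (f : MultilinearMap K (fun _ : Fin (i + 1) => A) A)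
    (g : MultilinearMap K (fun _ : Fin (j + 1) => A) A) (h : i + j = n) (v : Fin (n + 1) → A) :
    insertFirst f g h v = f (Fin.cons (g fun x : Fin (j + 1) => v ⟨x.val, by omega⟩)
      (fun y : Fin i => v ⟨j + 1 + y.val, by omega⟩)) := by
  rfl

lemma insertFirst_supersymmetricAt (𝒜 : ZMod 2 → Submodule K A) {i j n : ℕ}
    (f : SymMap 𝒜 i) (g : SymMap 𝒜 j) (h : i + j = n)
    (x y : Fin (n + 1)) (hxy : x.val + 1 = y.val) (hy : y.val ≠ j + 1) :
    SupersymmetricAt 𝒜 (insertFirst f.1 g.1 h) x y := by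
  intro p q v hx hy'
  rw [insertFirst_apply, insertFirst_apply]
  by_cases hlt : y.val < j + 1
  · have e1 : (fun k : Fin (j + 1) => v (Equiv.swap x y ⟨k.val, by omega⟩)) =
        fun k => (fun k : Fin (j + 1) => v ⟨k.val, by omega⟩)
          (Equiv.swap (⟨x.val, by omega⟩ : Fin (j + 1)) ⟨y.val, hlt⟩ k) := by
      funext k
      simp only [Equiv.swap_apply_def, Fin.ext_iff]
      split_ifs <;> rfl
    have e2 : (fun k : Fin i => v (Equiv.swap x y ⟨j + 1 + k.val, by omega⟩)) =
        fun k => v ⟨j + 1 + k.val, by omega⟩ := by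
      funext k
      rw [Equiv.swap_apply_of_ne_of_ne] <;> simp only [ne_eq, Fin.ext_iff] <;> omega
    rw [e1, e2, g.2 ⟨x.val, by omega⟩ ⟨y.val, hlt⟩ hxy p q
      (fun k : Fin (j + 1) => v ⟨k.val, by omega⟩) hx hy']
    exact f.1.cons_smul _ _ _
  · have e1 : (fun k : Fin (j + 1) => v (Equiv.swap x y ⟨k.val, by omega⟩)) =
        fun k => v ⟨k.val, by omega⟩ := by
      funext k
      rw [Equiv.swap_apply_of_ne_of_ne] <;> simp only [ne_eq, Fin.ext_iff] <;> omega
    set c := g.1 fun k : Fin (j + 1) => v ⟨k.val, by omega⟩ with hc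
    let x' : Fin i := ⟨x.val - (j + 1), by omega⟩
    let y' : Fin i := ⟨y.val - (j + 1), by omega⟩
    have hx' : (⟨j + 1 + x'.val, by omega⟩ : Fin (n + 1)) = x := by
      simp only [x', Fin.ext_iff]; omega
    have hy'' : (⟨j + 1 + y'.val, by omega⟩ : Fin (n + 1)) = y := by
      simp only [y', Fin.ext_iff]; omega
    let w : Fin i → A := fun k => v ⟨j + 1 + k.val, by omega⟩
    have hf := f.2 x'.succ y'.succ (by simp only [x', y', Fin.val_succ]; omega) p q
      (Fin.cons c w : Fin (i + 1) → A) (by simpa only [Fin.cons_succ, w, hx'] using hx)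
      (by simpa only [Fin.cons_succ, w, hy''] using hy')
    rw [e1, ← hc]
    refine Eq.trans (congrArg f.1 ?_) hf
    funext k
    refine Fin.cases ?_ (fun k => ?_) k
    · rw [Equiv.swap_apply_of_ne_of_ne (Fin.succ_ne_zero _).symm (Fin.succ_ne_zero _).symm]
      rfl
    · have e3 : Equiv.swap x'.succ y'.succ k.succ = (Equiv.swap x' y' k).succ := by
        simp only [Equiv.swap_apply_def, Fin.succ_inj]
        split_ifs <;> rfl
      rw [e3]
      simp only [Fin.cons_succ, w]
      congr 1
      simp only [Equiv.swap_apply_def, Fin.ext_iff, x', y']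
      split_ifs <;> first | omega | (simp only <;> omega)

end Multilinear

lemma comp_mem {K A : Type*} [Field K] [NonUnitalRing A] [Module K A]
    (𝒜 : ZMod 2 → Submodule K A) {n : ℕ} (f : A →ₗ[K] A) (F : SymMap 𝒜 n) :
    f.compMultilinearMap F.1 ∈ SymMap 𝒜 n := by
  intro x y hxy p q v hx hy
  simp [F.2 x y hxy p q v hx hy]

section Superalgebra

variable {K A : Type*} [Field K] [NonUnitalRing A] [Module K A]
variable (𝒜 : ZMod 2 → Submodule K A) [DirectSum.Decomposition 𝒜]

/-- The product `f ⊼ g`, on homogeneous elements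
`(f ⊼ g)(a₀, …, a_n) = ∑_{σ ∈ S(j+1, i)} ε(σ) f(g(a_{σ(0)}, …, a_{σ(j)}), a_{σ(j+1)}, …, a_{σ(n)})`
for `f ∈ D_i(A)`, `g ∈ D_j(A)`, `n = i + j`. -/
def wedge {i j n : ℕ} (f : SymMap 𝒜 i) (g : SymMap 𝒜 j) (h : i + j = n) : SymMap 𝒜 n :=
  ⟨shuffleSum 𝒜 (j + 1) (insertFirst f.1 g.1 h),
    shuffleSum_mem 𝒜 _ _ fun x y hxy hy => insertFirst_supersymmetricAt 𝒜 f g h x y hxy hy⟩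

/-- The Nijenhuis–Richardson bracket `D_i(A) × D_j(A) → D_{i+j}(A)`: the bilinear map which is
`[f, g] = f ⊼ g - (-1)^{|f||g|} g ⊼ f` for `f` and `g` homogeneous. -/
def nrBracket {i j n : ℕ} (f : SymMap 𝒜 i) (g : SymMap 𝒜 j) (h : i + j = n) : SymMap 𝒜 n :=
  wedge 𝒜 f g h - ∑ p : ZMod 2, ∑ q : ZMod 2,
    sgn K p q • wedge 𝒜 (parityPart 𝒜 q g) (parityPart 𝒜 p f) ((add_comm j i).trans h)

/-- The bracket of `D(A)`: the component of degree `n` of `[ω, η]` is `∑_{i=0}^n [ω_i, η_{n-i}]`. -/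
def bracket (ω η : D 𝒜) : D 𝒜 := fun n =>
  ∑ i : Fin (n + 1), nrBracket 𝒜 (ω i) (η (n - i)) (Nat.add_sub_cancel' (Nat.le_of_lt_succ i.2))

variable [IsScalarTower K A A] [SMulCommClass K A A]

variable (K A) in
/-- The multiplication `(a₀, …, a_n) ↦ a₀ a₁ ⋯ a_n`. -/
def mulMap : (n : ℕ) → MultilinearMap K (fun _ : Fin (n + 1) => A) A
  | 0 => MultilinearMap.ofSubsingleton K A A (0 : Fin 1) LinearMap.id
  | n + 1 => MultilinearMap.uncurryRight ((LinearMap.mul K A).compMultilinearMap (mulMap n))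

lemma mulMap_zero (v : Fin 1 → A) : mulMap K A 0 v = v 0 := rfl

lemma mulMap_succ (n : ℕ) (v : Fin (n + 2) → A) :
    mulMap K A (n + 1) v = mulMap K A n (fun i => v i.castSucc) * v (Fin.last (n + 1)) := rfl

lemma mulMap_mem [CommSuperalgebra 𝒜] (n : ℕ) : mulMap K A n ∈ SymMap 𝒜 n := by
  induction n with
  | zero => intro x y hxy; omega
  | succ n ih =>
    intro x y hxy p q v hx hy
    rw [mulMap_succ, mulMap_succ]
    by_cases hlast : y = Fin.last (n + 1)
    · subst hlast
      rw [Equiv.swap_apply_right]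
      cases n with
      | zero =>
        have hx0 : x = 0 := by
          simp only [Fin.ext_iff, Fin.val_last, Fin.val_zero] at hxy ⊢; omega
        subst hx0
        rw [mulMap_zero, mulMap_zero]
        simp only [Fin.castSucc_zero, Equiv.swap_apply_left]
        rw [CommSuperalgebra.mul_comm hy hx, sgn_comm]
      | succ m =>
        have hxm : x = (Fin.last (m + 1)).castSucc := by
          simp only [Fin.ext_iff, Fin.val_last, Fin.val_castSucc] at hxy ⊢; omega
        subst hxm
        rw [mulMap_succ, mulMap_succ, Equiv.swap_apply_left]
        have e : (fun i : Fin (m + 1) => v (Equiv.swap (Fin.last (m + 1)).castSucc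
            (Fin.last (m + 1 + 1)) i.castSucc.castSucc)) =
            fun i => v i.castSucc.castSucc := by
          funext i
          rw [Equiv.swap_apply_of_ne_of_ne] <;>
            simp only [ne_eq, Fin.ext_iff, Fin.val_castSucc, Fin.val_last] <;> omega
        rw [e, mul_assoc, mul_assoc, CommSuperalgebra.mul_comm hy hx, sgn_comm, mul_smul_comm]
    · have hyl : y.val < n + 1 := by
        have := y.2
        simp only [Fin.ext_iff, Fin.val_last] at hlast; omega
      have e1 : Equiv.swap x y (Fin.last (n + 1)) = Fin.last (n + 1) := by
        rw [Equiv.swap_apply_of_ne_of_ne] <;>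
          simp only [ne_eq, Fin.ext_iff, Fin.val_last] <;> omega
      have e2 : (fun i : Fin (n + 1) => v (Equiv.swap x y i.castSucc)) =
          fun i => (fun i : Fin (n + 1) => v i.castSucc)
            (Equiv.swap (⟨x.val, by omega⟩ : Fin (n + 1)) ⟨y.val, hyl⟩ i) := by
        funext i
        simp only [Equiv.swap_apply_def, Fin.ext_iff, Fin.val_castSucc]
        split_ifs <;> rfl
      rw [e1, e2, ih ⟨x.val, by omega⟩ ⟨y.val, hyl⟩ hxy p q
        (fun i : Fin (n + 1) => v i.castSucc) hx hy, smul_mul_assoc]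

/-- `μ_n ∈ D_n(A)`. -/
def mu [CommSuperalgebra 𝒜] (n : ℕ) : SymMap 𝒜 n := ⟨mulMap K A n, mulMap_mem 𝒜 n⟩

/-- The adjoint operator `ρ_n = [μ_n, -] : D(A) → D(A)`. -/
def rho [CommSuperalgebra 𝒜] (n : ℕ) (ω : D 𝒜) : D 𝒜 := bracket 𝒜 (Pi.single n (mu 𝒜 n)) ω

/-- A linear operator `f : A → A` as an element of `D_0(A) = Hom^*(A, A)`. -/
def ofLinear (f : A →ₗ[K] A) : SymMap 𝒜 0 :=
  ⟨MultilinearMap.ofSubsingleton K A A (0 : Fin 1) f, by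
    intro x y hxy
    omega⟩

/-- The higher antibracket `Φ^{n+1}_f ∈ D_n(A)` of a linear operator `f`: the sum over
`k = j + 1 = 1, …, n + 1` of `(-1)^{n+1-k}` times the map which on homogeneous elements is
`(a₁, …, a_{n+1}) ↦ ∑_{σ ∈ S(k, n+1-k)} ε(σ) f(a_{σ(1)} ⋯ a_{σ(k)}) a_{σ(k+1)} ⋯ a_{σ(n+1)}`. -/
def antibracket [CommSuperalgebra 𝒜] (f : A →ₗ[K] A) (n : ℕ) : SymMap 𝒜 n :=
  ∑ j : Fin (n + 1), (-1 : K) ^ (n - j.val) •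
    ⟨shuffleSum 𝒜 (j.val + 1) (insertFirst (mulMap K A (n - j.val))
      (f.compMultilinearMap (mulMap K A j.val)) (Nat.sub_add_cancel (Nat.le_of_lt_succ j.2))),
    shuffleSum_mem 𝒜 _ _ fun x y hxy hy => insertFirst_supersymmetricAt 𝒜 (mu 𝒜 (n - j.val))
      ⟨_, comp_mem 𝒜 f (mu 𝒜 j.val)⟩ _ x y hxy hy⟩

end Superalgebra

end HigherAntibrackets

open HigherAntibrackets

universe u v

/-! For fixed `f` and `n`, let s_j (`symWord`) be the signed shuffle sum of f(a_0⋯a_j) a_{j+1}⋯a_n.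
Everything in the theorem is a rational combination of s_0, …, s_n: the antibracket is ∑ (-1)^{n-j}
s_j, and ρ_i f = s_0 - s_i in degree i. With l = n - j, counting words gives ρ_1 s_j =
((l+1)(2-l)/2) s_j - ((j+1)(j+2)/2) s_{j+1} (`wedge_mu_one_symWord`, `wedge_symWord_mu_one`). The
problem thus becomes one about vectors in ℚ^{n+1}, independent of the field, the algebra and `f`.

Existence is a dimension count (`exists_iterComb_eq`). If `f` is a derivation, then s_j = C(n,j)
s_0, which suggests the functional `derivEval`: x ↦ ∑ C(n,j) x_j. It kills the coefficients of every
ρ_1^{n-i} ρ_i f and those of the antibracket. Its kernel has dimension n, so n linearly independent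
vectors in it span it.

Independence (`iterComb_injective`) goes by induction on n: `rhoCoeff` is injective, its subdiagonal
being nonzero, and for n > 0 the vector of ρ_{n+1} f is not in its image (`eq_zero_of_rhoCoeff_eq`).

Uniqueness over a given field needs an algebra in which the s_j do not degenerate. In K[X] with all
elements even, take `f` to be the coefficient of X^{k+1}; evaluation at (X, …, X) then isolates s_k.
So the coefficient vectors agree, and independence applies again.

The two word counts are made with sums over the full symmetric group (`symmetrize`), which absorb
any permutation of the arguments; in characteristic 0 the factorials relating them to shuffle sums
can be cancelled. -/

namespace HigherAntibrackets

/-! ### Adjacent transpositions and the cocycle property of Koszul signs. -/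

/-- Induction on permutations by composing with adjacent transpositions on the left. -/
lemma perm_adjacent_induction {N : ℕ} {P : Equiv.Perm (Fin N) → Prop} (one : P 1)
    (swap_mul : ∀ (σ : Equiv.Perm (Fin N)) (a b : Fin N), a.val + 1 = b.val → P σ →
      P (Equiv.swap a b * σ)) (σ : Equiv.Perm (Fin N)) : P σ := by
  cases N with
  | zero => rwa [Subsingleton.elim σ 1]
  | succ n =>
    have h : σ ∈ Submonoid.closure
        (Set.range fun i : Fin n => Equiv.swap i.castSucc i.succ) := by
      rw [Equiv.Perm.mclosure_swap_castSucc_succ]; trivial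
    induction h using Submonoid.closure_induction_left with
    | one => exact one
    | mul_left x hx y _ ih =>
      obtain ⟨i, rfl⟩ := hx
      exact swap_mul _ _ _ (by simp) ih

section Koszul

variable {K : Type*} [Field K] {N : ℕ}

lemma koszulSign_one (par : Fin N → ZMod 2) : koszulSign K par 1 = 1 := by
  rw [koszulSign, Finset.filter_false_of_mem, Finset.card_empty, pow_zero]
  rintro x - ⟨h1, h2, -⟩
  exact absurd h1 (not_lt_of_gt h2)

lemma koszulSign_swap (par : Fin N → ZMod 2) {a b : Fin N} (hab : a.val + 1 = b.val) :
    koszulSign K par (Equiv.swap a b) = sgn K (par a) (par b) := by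
  have := koszulSign_mul_swap (K := K) par 1 hab
  simpa [koszulSign_one] using this

lemma koszulSign_of_even (σ : Equiv.Perm (Fin N)) :
    koszulSign K (fun _ => 0) σ = 1 := by
  simp [koszulSign]

/-- The cocycle identity that makes `symAct` a group action: after `τ` has been applied, `σ` sees
the permuted parities. -/
lemma koszulSign_mul (τ σ : Equiv.Perm (Fin N)) (par : Fin N → ZMod 2) :
    koszulSign K par (τ * σ) = koszulSign K par τ * koszulSign K (par ∘ τ) σ := by
  induction τ using perm_adjacent_induction generalizing par with
  | one => simp [koszulSign_one]
  | swap_mul τ a b hab ih =>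
    have h1 := koszulSign_swap_mul (K := K) par (τ * σ) hab
    have h2 := koszulSign_swap_mul (K := K) par τ hab
    have h3 : koszulSign K (par ∘ Equiv.swap a b) (τ * σ) = _ := ih _
    rw [mul_assoc]
    have h4 : par ∘ ⇑(Equiv.swap a b * τ) = (par ∘ Equiv.swap a b) ∘ τ := rfl
    rw [h4]
    have hs := sgn_mul_self K (par a) (par b)
    rw [h1, h2] at h3
    calc _ = sgn K (par a) (par b) * sgn K (par a) (par b) *
          koszulSign K par (Equiv.swap a b * (τ * σ)) := by rw [hs, one_mul]
      _ = _ := by rw [mul_assoc, h3, ← mul_assoc, ← mul_assoc, hs, one_mul]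

end Koszul

/-! ### The signed action of the symmetric group on multilinear maps. -/

section Action

variable {K A : Type*} [Field K] [NonUnitalRing A] [Module K A]
variable (𝒜 : ZMod 2 → Submodule K A) [DirectSum.Decomposition 𝒜] {N : ℕ}

lemma sum_proj (a : A) : ∑ p, proj 𝒜 p a = a := by
  have h := DirectSum.sum_univ_of (DirectSum.decompose 𝒜 a)
  have := congrArg (DirectSum.decompose 𝒜).symm h
  rw [DirectSum.decompose_symm_sum] at this
  simp only [DirectSum.decompose_symm_of, Equiv.symm_apply_apply] at this
  exact this

/-- Two multilinear maps which agree on homogeneous elements are equal. -/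
lemma multilinearMap_ext_homogeneous {F G : MultilinearMap K (fun _ : Fin N => A) A}
    (h : ∀ (ε : Fin N → ZMod 2) (v : Fin N → A), (∀ i, v i ∈ 𝒜 (ε i)) → F v = G v) : F = G := by
  ext v
  have hv : v = fun i => ∑ p, proj 𝒜 p (v i) := funext fun i => (sum_proj 𝒜 (v i)).symm
  rw [hv, MultilinearMap.map_sum, MultilinearMap.map_sum]
  exact Finset.sum_congr rfl fun ε _ => h ε _ fun i => proj_mem 𝒜 _ _

/-- The action of permutations on multilinear maps, with Koszul signs. -/
def symAct (σ : Equiv.Perm (Fin N)) :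
    MultilinearMap K (fun _ : Fin N => A) A →ₗ[K] MultilinearMap K (fun _ : Fin N => A) A where
  toFun F := homogExt 𝒜 fun ε => koszulSign K ε σ • F.domDomCongr σ
  map_add' F G := by
    refine multilinearMap_ext_homogeneous 𝒜 fun ε v hv => ?_
    simp [homogExt_apply 𝒜 _ ε v hv]
  map_smul' c F := by
    refine multilinearMap_ext_homogeneous 𝒜 fun ε v hv => ?_
    simp [homogExt_apply 𝒜 _ ε v hv, smul_comm c]

lemma symAct_apply (σ : Equiv.Perm (Fin N)) (F : MultilinearMap K (fun _ : Fin N => A) A)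
    (ε : Fin N → ZMod 2) (v : Fin N → A) (hv : ∀ i, v i ∈ 𝒜 (ε i)) :
    symAct 𝒜 σ F v = koszulSign K ε σ • F fun i => v (σ i) := by
  simp [symAct, homogExt_apply 𝒜 _ ε v hv]

lemma symAct_one (F : MultilinearMap K (fun _ : Fin N => A) A) : symAct 𝒜 1 F = F := by
  refine multilinearMap_ext_homogeneous 𝒜 fun ε v hv => ?_
  simp [symAct_apply 𝒜 _ _ ε v hv, koszulSign_one]

lemma symAct_mul (τ σ : Equiv.Perm (Fin N)) (F : MultilinearMap K (fun _ : Fin N => A) A) :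
    symAct 𝒜 (τ * σ) F = symAct 𝒜 τ (symAct 𝒜 σ F) := by
  refine multilinearMap_ext_homogeneous 𝒜 fun ε v hv => ?_
  rw [symAct_apply 𝒜 _ _ ε v hv, symAct_apply 𝒜 _ _ ε v hv,
    symAct_apply 𝒜 _ _ (ε ∘ τ) _ fun i => hv (τ i), koszulSign_mul, mul_smul]
  rfl

lemma symAct_swap_apply {a b : Fin N} (hab : a.val + 1 = b.val)
    (F : MultilinearMap K (fun _ : Fin N => A) A)
    (ε : Fin N → ZMod 2) (v : Fin N → A) (hv : ∀ i, v i ∈ 𝒜 (ε i)) :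
    symAct 𝒜 (Equiv.swap a b) F v = sgn K (ε a) (ε b) • F fun i => v (Equiv.swap a b i) := by
  rw [symAct_apply 𝒜 _ _ ε v hv, koszulSign_swap _ hab]

lemma symAct_swap_of_supersymmetricAt {a b : Fin N} (hab : a.val + 1 = b.val)
    {F : MultilinearMap K (fun _ : Fin N => A) A} (hF : SupersymmetricAt 𝒜 F a b) :
    symAct 𝒜 (Equiv.swap a b) F = F := by
  refine multilinearMap_ext_homogeneous 𝒜 fun ε v hv => ?_
  rw [symAct_swap_apply 𝒜 hab _ ε v hv, hF _ _ v (hv a) (hv b), smul_smul, sgn_mul_self, one_smul]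

/-- The sum of all translates of a multilinear map under the action of permutations. -/
def symmetrize :
    MultilinearMap K (fun _ : Fin N => A) A →ₗ[K] MultilinearMap K (fun _ : Fin N => A) A :=
  ∑ σ, symAct 𝒜 σ

lemma symmetrize_apply (F : MultilinearMap K (fun _ : Fin N => A) A) :
    symmetrize 𝒜 F = ∑ σ, symAct 𝒜 σ F := by
  simp [symmetrize]

lemma symmetrize_symAct (τ : Equiv.Perm (Fin N)) (F : MultilinearMap K (fun _ : Fin N => A) A) :
    symmetrize 𝒜 (symAct 𝒜 τ F) = symmetrize 𝒜 F := by
  simp only [symmetrize_apply, ← symAct_mul]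
  exact Equiv.sum_comp (Equiv.mulRight τ) fun σ => symAct 𝒜 σ F

lemma symAct_symmetrize (τ : Equiv.Perm (Fin N)) (F : MultilinearMap K (fun _ : Fin N => A) A) :
    symAct 𝒜 τ (symmetrize 𝒜 F) = symmetrize 𝒜 F := by
  simp only [symmetrize_apply, map_sum, ← symAct_mul]
  exact Equiv.sum_comp (Equiv.mulLeft τ) fun σ => symAct 𝒜 σ F

lemma shuffleSum_eq_sum_symAct (p : ℕ) (F : MultilinearMap K (fun _ : Fin N => A) A) :
    shuffleSum 𝒜 p F = ∑ σ ∈ shuffles N p, symAct 𝒜 σ F := by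
  refine multilinearMap_ext_homogeneous 𝒜 fun ε v hv => ?_
  rw [shuffleSum_apply 𝒜 p F ε v hv, sum_apply]
  exact Finset.sum_congr rfl fun σ _ => (symAct_apply 𝒜 σ F ε v hv).symm

end Action

/-! ### Shuffles as coset representatives of a Young subgroup. -/

section Young

/-- The embedding of `S_p × S_q` into `S_{p+q}` as a Young subgroup. -/
def young {p q : ℕ} : Equiv.Perm (Fin p) × Equiv.Perm (Fin q) →* Equiv.Perm (Fin (p + q)) :=
  (finSumFinEquiv.permCongrHom : Equiv.Perm (Fin p ⊕ Fin q) ≃* _).toMonoidHom.comp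
    (Equiv.Perm.sumCongrHom (Fin p) (Fin q))

variable {p q : ℕ}

lemma young_castAdd (τ : Equiv.Perm (Fin p) × Equiv.Perm (Fin q)) (i : Fin p) :
    young τ (Fin.castAdd q i) = Fin.castAdd q (τ.1 i) := by
  simp [young, Equiv.permCongrHom, Equiv.permCongr_apply]

lemma young_natAdd (τ : Equiv.Perm (Fin p) × Equiv.Perm (Fin q)) (i : Fin q) :
    young τ (Fin.natAdd p i) = Fin.natAdd p (τ.2 i) := by
  simp [young, Equiv.permCongrHom, Equiv.permCongr_apply]

lemma mem_shuffles_iff (σ : Equiv.Perm (Fin (p + q))) :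
    σ ∈ shuffles (p + q) p ↔
      StrictMono (fun i => σ (Fin.castAdd q i)) ∧ StrictMono (fun i => σ (Fin.natAdd p i)) := by
  simp only [shuffles, Finset.mem_filter, Finset.mem_univ, true_and]
  refine and_congr ⟨fun h i j hij => h _ _ (Fin.lt_def.2 hij) (by simp), fun h i j hij hj => ?_⟩
    ⟨fun h i j hij => h _ _ (by simpa using hij) (by simp), fun h i j hij hi => ?_⟩
  · have hi : i.val < p := lt_trans hij hj
    exact h (a := ⟨i, hi⟩) (b := ⟨j, hj⟩) hij
  · have hj : p ≤ j.val := le_trans hi (le_of_lt hij)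
    have := h (a := ⟨i - p, by omega⟩) (b := ⟨j - p, by omega⟩)
      (by simp only [Fin.lt_def] at hij ⊢; omega)
    have e1 : Fin.natAdd p (⟨i - p, by omega⟩ : Fin q) = i := by ext; simp; omega
    have e2 : Fin.natAdd p (⟨j - p, by omega⟩ : Fin q) = j := by ext; simp; omega
    simpa only [e1, e2] using this

/-- A monotone permutation is the identity, so sorting must undo `τ` exactly. This recovers the
Young factor from a product of a shuffle with a Young element. -/
lemma sort_comp_of_strictMono {α : Type*} [LinearOrder α] {n : ℕ} {g : Fin n → α}
    (hg : StrictMono g) (τ : Equiv.Perm (Fin n)) : Tuple.sort (g ∘ τ) = τ⁻¹ := by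
  have h1 : Monotone ((g ∘ τ) ∘ Tuple.sort (g ∘ τ)) := Tuple.monotone_sort _
  have h2 : Monotone (⇑(τ * Tuple.sort (g ∘ τ))) := fun i j hij => by
    have := h1 hij
    exact hg.le_iff_le.1 this
  have h3 := (Equiv.Perm.monotone_iff _).1 h2
  exact (inv_eq_of_mul_eq_one_right h3).symm

lemma strictMono_comp_sort {α : Type*} [LinearOrder α] {n : ℕ} {g : Fin n → α}
    (hg : Function.Injective g) : StrictMono (g ∘ Tuple.sort g) :=
  (Tuple.monotone_sort g).strictMono_of_injective (hg.comp (Tuple.sort g).injective)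

/-- Every permutation is uniquely the product of a shuffle and an element of the Young subgroup. -/
lemma sum_shuffles_young {M : Type*} [AddCommMonoid M] (f : Equiv.Perm (Fin (p + q)) → M) :
    ∑ σ, f σ = ∑ x ∈ shuffles (p + q) p ×ˢ
      (Finset.univ : Finset (Equiv.Perm (Fin p) × Equiv.Perm (Fin q))), f (x.1 * young x.2) := by
  -- The permutations that sort the values of `π` on each of the two blocks; multiplying `π` on the
  -- right by them gives the shuffle in its coset.
  let s : Equiv.Perm (Fin (p + q)) → Equiv.Perm (Fin p) × Equiv.Perm (Fin q) := fun π =>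
    (Tuple.sort fun i => π (Fin.castAdd q i), Tuple.sort fun i => π (Fin.natAdd p i))
  symm
  refine Finset.sum_bij' (fun x _ => x.1 * young x.2) (fun π _ => (π * young (s π), (s π)⁻¹))
    (fun _ _ => Finset.mem_univ _) ?_ ?_ ?_ fun _ _ => rfl
  · intro π _
    rw [Finset.mem_product]
    refine ⟨(mem_shuffles_iff _).2 ⟨?_, ?_⟩, Finset.mem_univ _⟩
    · simp only [Equiv.Perm.mul_apply, young_castAdd]
      exact strictMono_comp_sort (g := fun i => π (Fin.castAdd q i))
        (π.injective.comp (Fin.castAdd_injective _ _))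
    · simp only [Equiv.Perm.mul_apply, young_natAdd]
      exact strictMono_comp_sort (g := fun i => π (Fin.natAdd p i))
        (π.injective.comp (Fin.natAdd_injective _ _))
  · rintro ⟨σ, τ⟩ hx
    have hσ := (mem_shuffles_iff σ).1 (Finset.mem_product.1 hx).1
    have hs : s (σ * young τ) = τ⁻¹ := by
      simp only [s, Equiv.Perm.mul_apply, young_castAdd, young_natAdd]
      exact Prod.ext (sort_comp_of_strictMono hσ.1 τ.1) (sort_comp_of_strictMono hσ.2 τ.2)
    simp only [hs, map_inv, inv_inv, mul_inv_cancel_right]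
  · intro π _
    simp

variable {K A : Type*} [Field K] [NonUnitalRing A] [Module K A]
variable (𝒜 : ZMod 2 → Submodule K A) [DirectSum.Decomposition 𝒜]

lemma young_swap_left (a b : Fin p) :
    young (Equiv.swap a b, (1 : Equiv.Perm (Fin q))) =
      Equiv.swap (Fin.castAdd q a) (Fin.castAdd q b) := by
  ext i
  refine Fin.addCases (fun i => ?_) (fun i => ?_) i
  · rw [young_castAdd, (Fin.castAdd_injective p q).map_swap]
  · rw [young_natAdd, Equiv.swap_apply_of_ne_of_ne] <;> simp [Fin.ext_iff] <;> omega

lemma young_swap_right (a b : Fin q) :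
    young ((1 : Equiv.Perm (Fin p)), Equiv.swap a b) =
      Equiv.swap (Fin.natAdd p a) (Fin.natAdd p b) := by
  ext i
  refine Fin.addCases (fun i => ?_) (fun i => ?_) i
  · rw [young_castAdd, Equiv.swap_apply_of_ne_of_ne] <;> simp [Fin.ext_iff] <;> omega
  · rw [young_natAdd, (Fin.natAdd_injective q p).map_swap]

/-- The Young subgroup is generated by the adjacent transpositions that do not straddle the cut; the
condition `y.val ≠ p` excludes just the straddling one. -/
lemma symAct_young {F : MultilinearMap K (fun _ : Fin (p + q) => A) A}
    (hF : ∀ x y : Fin (p + q), x.val + 1 = y.val → y.val ≠ p → SupersymmetricAt 𝒜 F x y)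
    (τ : Equiv.Perm (Fin p) × Equiv.Perm (Fin q)) : symAct 𝒜 (young τ) F = F := by
  have h1 : ∀ τ : Equiv.Perm (Fin p), symAct 𝒜 (young (τ, (1 : Equiv.Perm (Fin q)))) F = F := by
    intro τ
    induction τ using perm_adjacent_induction with
    | one => rw [← Prod.one_eq_mk, map_one, symAct_one]
    | swap_mul σ a b hab ih =>
      rw [← one_mul (1 : Equiv.Perm (Fin q)), ← Prod.mk_mul_mk, map_mul, symAct_mul, ih,
        young_swap_left]
      have hab' : (Fin.castAdd q a).val + 1 = (Fin.castAdd q b).val := hab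
      refine symAct_swap_of_supersymmetricAt 𝒜 hab' (hF _ _ hab' ?_)
      simp only [Fin.val_castAdd]; omega
  have h2 : ∀ τ : Equiv.Perm (Fin q), symAct 𝒜 (young ((1 : Equiv.Perm (Fin p)), τ)) F = F := by
    intro τ
    induction τ using perm_adjacent_induction with
    | one => rw [← Prod.one_eq_mk, map_one, symAct_one]
    | swap_mul σ a b hab ih =>
      rw [← one_mul (1 : Equiv.Perm (Fin p)), ← Prod.mk_mul_mk, map_mul, symAct_mul, ih,
        young_swap_right]
      have hab' : (Fin.natAdd p a).val + 1 = (Fin.natAdd p b).val := by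
        simp only [Fin.val_natAdd]; omega
      refine symAct_swap_of_supersymmetricAt 𝒜 hab' (hF _ _ hab' ?_)
      simp only [Fin.val_natAdd]; omega
  rw [← Prod.fst_mul_snd τ, map_mul, symAct_mul]
  exact (congrArg _ (h2 τ.2)).trans (h1 τ.1)

/-- For a map which is supersymmetric in its first `p` and in its last `q` arguments, the sum over
all permutations is `p! q!` times the sum over shuffles. -/
lemma symmetrize_eq_smul_shuffleSum {N : ℕ} (h : p + q = N)
    {F : MultilinearMap K (fun _ : Fin N => A) A}
    (hF : ∀ x y : Fin N, x.val + 1 = y.val → y.val ≠ p → SupersymmetricAt 𝒜 F x y) :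
    symmetrize 𝒜 F = ((p.factorial * q.factorial : ℕ) : K) • shuffleSum 𝒜 p F := by
  subst h
  rw [symmetrize_apply, sum_shuffles_young, shuffleSum_eq_sum_symAct, Finset.sum_product,
    Finset.smul_sum]
  refine Finset.sum_congr rfl fun σ _ => ?_
  simp only [symAct_mul, symAct_young 𝒜 hF]
  rw [Finset.sum_const, Finset.card_univ, Fintype.card_prod, Fintype.card_perm, Fintype.card_perm,
    Fintype.card_fin, Fintype.card_fin, Nat.cast_smul_eq_nsmul]

lemma symmetrize_insertFirst {i j n : ℕ} (F : SymMap 𝒜 i) (G : SymMap 𝒜 j) (h : i + j = n) :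
    symmetrize 𝒜 (insertFirst F.1 G.1 h) =
      (((j + 1).factorial * i.factorial : ℕ) : K) • (wedge 𝒜 F G h).1 :=
  symmetrize_eq_smul_shuffleSum 𝒜 (by omega)
    fun x y hxy hy => insertFirst_supersymmetricAt 𝒜 F G h x y hxy hy

end Young

/-- Passing a product costs the same sign as passing its factors one by one. -/
lemma sgn_add_left (K : Type*) [Field K] (p q r : ZMod 2) :
    sgn K (p + q) r = sgn K p r * sgn K q r := by
  have h : ∀ p q r : ZMod 2, (p + q = 1 ∧ r = 1) ↔
      ¬ ((p = 1 ∧ r = 1) ↔ (q = 1 ∧ r = 1)) := by decide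
  simp only [sgn_eq_ite, h]
  split_ifs <;> first | tauto | simp

/-! ### Multiplying by a last entry, merging two neighbours, and symmetrizing. -/

section Operations

variable {K A : Type*} [Field K] [NonUnitalRing A] [Module K A]
  [IsScalarTower K A A] [SMulCommClass K A A] {N : ℕ}

/-- The multilinear map `(a₀, …, a_N) ↦ F(a₀, …, a_{N-1}) a_N`. -/
def mulLast (F : MultilinearMap K (fun _ : Fin N => A) A) :
    MultilinearMap K (fun _ : Fin (N + 1) => A) A :=
  MultilinearMap.uncurryRight ((LinearMap.mul K A).compMultilinearMap F)

lemma mulLast_apply (F : MultilinearMap K (fun _ : Fin N => A) A) (v : Fin (N + 1) → A) :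
    mulLast F v = F (fun i => v i.castSucc) * v (Fin.last N) := rfl

lemma mulLast_smul (c : K) (F : MultilinearMap K (fun _ : Fin N => A) A) :
    mulLast (c • F) = c • mulLast F := by
  ext v
  exact smul_mul_assoc _ _ _

lemma mulLast_sum {ι : Type*} (s : Finset ι) (F : ι → MultilinearMap K (fun _ : Fin N => A) A) :
    mulLast (∑ x ∈ s, F x) = ∑ x ∈ s, mulLast (F x) := by
  ext v; simp [mulLast_apply, Finset.sum_mul]

/-- The family obtained from `v` by multiplying the entries at the places `i` and `i + 1`. -/
def mulAt (i : Fin N) (v : Fin (N + 1) → A) (k : Fin N) : A :=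
  if k < i then v k.castSucc else if k = i then v k.castSucc * v k.succ else v k.succ

/-- This is what makes `insertMul` multilinear: a change of one entry is felt in a single entry
after merging, through the identity or through multiplication by a fixed neighbour. -/
lemma mulAt_update (i : Fin N) (v : Fin (N + 1) → A) (p : Fin (N + 1)) :
    ∃ (k : Fin N) (g : A →ₗ[K] A), ∀ x : A,
      mulAt i (Function.update v p x) = Function.update (mulAt i v) k (g x) := by
  rcases lt_trichotomy p i.castSucc with h | rfl | h
  · have hp : p.val < N := by have := i.2; simp only [Fin.lt_def, Fin.val_castSucc] at h; omega
    refine ⟨⟨p, hp⟩, LinearMap.id, fun x => funext fun k => ?_⟩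
    simp only [mulAt, Function.update_apply, Fin.ext_iff, Fin.lt_def, Fin.val_castSucc,
      Fin.val_succ, LinearMap.id_apply] at h ⊢
    split_ifs <;> first | rfl | omega
  · refine ⟨i, LinearMap.mulRight K (v i.succ), fun x => funext fun k => ?_⟩
    simp only [mulAt, Function.update_apply, Fin.ext_iff, Fin.lt_def, Fin.val_castSucc,
      Fin.val_succ, LinearMap.mulRight_apply]
    split_ifs with h1 h2 h3 <;> first | rfl | omega | skip
    rw [show k = i from Fin.ext (by omega)]
  · by_cases hi : p = i.succ
    · subst hi
      refine ⟨i, LinearMap.mulLeft K (v i.castSucc), fun x => funext fun k => ?_⟩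
      simp only [mulAt, Function.update_apply, Fin.ext_iff, Fin.lt_def, Fin.val_castSucc,
        Fin.val_succ, LinearMap.mulLeft_apply]
      split_ifs with h1 h2 h3 <;> first | rfl | omega | skip
      rw [show k = i from Fin.ext (by omega)]
    · refine ⟨⟨p - 1, by omega⟩, LinearMap.id, fun x => funext fun k => ?_⟩
      simp only [mulAt, Function.update_apply, Fin.ext_iff, Fin.lt_def, Fin.val_castSucc,
        Fin.val_succ, LinearMap.id_apply] at h hi ⊢
      split_ifs <;> first | rfl | omega

/-- The multilinear map `(a₀, …, a_N) ↦ F(a₀, …, a_i a_{i+1}, …, a_N)`. -/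
def insertMul (i : Fin N) (F : MultilinearMap K (fun _ : Fin N => A) A) :
    MultilinearMap K (fun _ : Fin (N + 1) => A) A :=
  MultilinearMap.mk' (fun v => F (mulAt i v))
    (fun v p x y => by
      obtain ⟨k, g, hg⟩ := mulAt_update (K := K) i v p
      simp [hg])
    (fun v p c x => by
      obtain ⟨k, g, hg⟩ := mulAt_update (K := K) i v p
      simp [hg])

lemma insertMul_apply (i : Fin N) (F : MultilinearMap K (fun _ : Fin N => A) A)
    (v : Fin (N + 1) → A) : insertMul i F v = F (mulAt i v) := rfl

lemma insertMul_smul (i : Fin N) (c : K) (F : MultilinearMap K (fun _ : Fin N => A) A) :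
    insertMul i (c • F) = c • insertMul i F := by
  ext v; simp [insertMul_apply]

lemma insertMul_sum (i : Fin N) {ι : Type*} (s : Finset ι)
    (F : ι → MultilinearMap K (fun _ : Fin N => A) A) :
    insertMul i (∑ x ∈ s, F x) = ∑ x ∈ s, insertMul i (F x) := by
  ext v; simp [insertMul_apply]

lemma mulMap_mulAt (n : ℕ) (i : Fin (n + 1)) (v : Fin (n + 2) → A) :
    mulMap K A n (mulAt i v) = mulMap K A (n + 1) v := by
  induction n with
  | zero =>
    have hi : i = 0 := Subsingleton.elim (α := Fin 1) _ _
    subst hi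
    rfl
  | succ n ih =>
    rw [mulMap_succ, mulMap_succ (n + 1)]
    refine Fin.lastCases ?_ (fun i => ?_) i
    · have e1 : (fun k : Fin (n + 1) => mulAt (Fin.last (n + 1)) v k.castSucc) =
          fun k => v k.castSucc.castSucc := by
        funext k
        simp [mulAt, Fin.castSucc_lt_last]
      have e2 : mulAt (Fin.last (n + 1)) v (Fin.last (n + 1)) =
          v (Fin.last (n + 1)).castSucc * v (Fin.last (n + 2)) := by
        simp [mulAt]
      rw [e1, e2, mulMap_succ, mul_assoc]
    · have e1 : (fun k : Fin (n + 1) => mulAt i.castSucc v k.castSucc) =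
          mulAt i fun k => v k.castSucc := by
        funext k
        simp only [mulAt, Fin.castSucc_lt_castSucc_iff, Fin.castSucc_inj, Fin.succ_castSucc]
      have e2 : mulAt i.castSucc v (Fin.last (n + 1)) = v (Fin.last (n + 2)) := by
        have h1 : ¬ Fin.last (n + 1) < i.castSucc := not_lt_of_gt (Fin.castSucc_lt_last i)
        have h2 : Fin.last (n + 1) ≠ i.castSucc := (Fin.castSucc_lt_last i).ne'
        simp [mulAt, h1, h2]
      rw [e1, e2, ih]

variable (𝒜 : ZMod 2 → Submodule K A) [DirectSum.Decomposition 𝒜]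

lemma mulLast_symAct_swap {a b : Fin N} (hab : a.val + 1 = b.val)
    (F : MultilinearMap K (fun _ : Fin N => A) A) :
    mulLast (symAct 𝒜 (Equiv.swap a b) F) =
      symAct 𝒜 (Equiv.swap a.castSucc b.castSucc) (mulLast F) := by
  refine multilinearMap_ext_homogeneous 𝒜 fun ε v hv => ?_
  rw [mulLast_apply, symAct_swap_apply 𝒜 hab F (fun i => ε i.castSucc) _ fun i => hv _,
    symAct_swap_apply 𝒜 (a := a.castSucc) (b := b.castSucc) hab _ ε v hv, mulLast_apply,
    Equiv.swap_apply_of_ne_of_ne (Fin.castSucc_lt_last a).ne' (Fin.castSucc_lt_last b).ne',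
    smul_mul_assoc]
  simp only [(Fin.castSucc_injective N).map_swap]

/-- The last place is fixed, so a permutation of the first `N` places extends to all `N + 1` and is
absorbed by the outer symmetrization. -/
lemma symmetrize_mulLast_symAct (σ : Equiv.Perm (Fin N))
    (F : MultilinearMap K (fun _ : Fin N => A) A) :
    symmetrize 𝒜 (mulLast (symAct 𝒜 σ F)) = symmetrize 𝒜 (mulLast F) := by
  induction σ using perm_adjacent_induction with
  | one => rw [symAct_one]
  | swap_mul σ a b hab ih => rw [symAct_mul, mulLast_symAct_swap 𝒜 hab, symmetrize_symAct, ih]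

lemma symmetrize_mulLast_symmetrize (F : MultilinearMap K (fun _ : Fin N => A) A) :
    symmetrize 𝒜 (mulLast (symmetrize 𝒜 F)) = (N.factorial : K) • symmetrize 𝒜 (mulLast F) := by
  rw [symmetrize_apply 𝒜 F, mulLast_sum, map_sum]
  simp only [symmetrize_mulLast_symAct]
  rw [Finset.sum_const, Finset.card_univ, Fintype.card_perm, Fintype.card_fin,
    Nat.cast_smul_eq_nsmul]

variable [CommSuperalgebra 𝒜]

lemma mulAt_mem (i : Fin N) {ε : Fin (N + 1) → ZMod 2} {v : Fin (N + 1) → A}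
    (hv : ∀ k, v k ∈ 𝒜 (ε k)) (k : Fin N) :
    mulAt i v k ∈ 𝒜 (if k < i then ε k.castSucc else
      if k = i then ε k.castSucc + ε k.succ else ε k.succ) := by
  unfold mulAt
  split_ifs
  · exact hv _
  · exact CommSuperalgebra.mul_mem (hv _) (hv _)
  · exact hv _

/-- The transposition misses the merged entry, so it lifts to an adjacent transposition, shifted by
one beyond `i`. Which one it is does not matter once the result is symmetrized. -/
lemma insertMul_symAct_swap_of_ne (i : Fin N) {a b : Fin N} (hab : a.val + 1 = b.val)
    (ha : i ≠ a) (hb : i ≠ b) (F : MultilinearMap K (fun _ : Fin N => A) A) :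
    ∃ τ, insertMul i (symAct 𝒜 (Equiv.swap a b) F) = symAct 𝒜 τ (insertMul i F) := by
  rcases lt_or_gt_of_ne ha with h | h
  · refine ⟨Equiv.swap a.succ b.succ, multilinearMap_ext_homogeneous 𝒜 fun ε v hv => ?_⟩
    have h' : i < b := by simp only [Fin.lt_def] at *; omega
    rw [insertMul_apply, symAct_swap_apply 𝒜 hab F _ _ (mulAt_mem 𝒜 i hv),
      symAct_swap_apply 𝒜 (a := a.succ) (b := b.succ) (by simpa using hab) _ ε v hv,
      insertMul_apply]
    simp only [not_lt_of_gt h, not_lt_of_gt h', h.ne', h'.ne', if_false]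
    congr 2
    funext k
    simp only [mulAt, Equiv.swap_apply_def, Fin.ext_iff, Fin.lt_def, Fin.val_castSucc,
      Fin.val_succ] at *
    split_ifs <;> first | rfl | omega
  · refine ⟨Equiv.swap a.castSucc b.castSucc, multilinearMap_ext_homogeneous 𝒜 fun ε v hv => ?_⟩
    have h' : b < i := by simp only [Fin.lt_def, ne_eq, Fin.ext_iff] at *; omega
    rw [insertMul_apply, symAct_swap_apply 𝒜 hab F _ _ (mulAt_mem 𝒜 i hv),
      symAct_swap_apply 𝒜 (a := a.castSucc) (b := b.castSucc) hab _ ε v hv,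
      insertMul_apply]
    simp only [show a < i from h, h', if_true]
    congr 2
    funext k
    simp only [mulAt, Equiv.swap_apply_def, Fin.ext_iff, Fin.lt_def, Fin.val_castSucc,
      Fin.val_succ] at *
    split_ifs <;> first | rfl | omega

/-- Exchanging a product with its neighbour means moving that neighbour past both factors, that is,
two adjacent transpositions whose signs multiply by `sgn_add_left`. -/
lemma insertMul_symAct_swap_left {a b : Fin N} (hab : a.val + 1 = b.val)
    (F : MultilinearMap K (fun _ : Fin N => A) A) :
    insertMul a (symAct 𝒜 (Equiv.swap a b) F) =
      symAct 𝒜 (Equiv.swap b.castSucc b.succ * Equiv.swap a.castSucc b.castSucc)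
        (insertMul b F) := by
  refine multilinearMap_ext_homogeneous 𝒜 fun ε v hv => ?_
  have hlt : a < b := by rw [Fin.lt_def]; omega
  have hs : a.succ = b.castSucc := by ext; simpa using hab
  rw [insertMul_apply, symAct_swap_apply 𝒜 hab F _ _ (mulAt_mem 𝒜 a hv),
    symAct_apply 𝒜 _ _ ε v hv, insertMul_apply,
    koszulSign_mul_swap ε _ (a := a.castSucc) (b := b.castSucc) hab,
    koszulSign_swap ε (a := b.castSucc) (b := b.succ) (by simp), Equiv.swap_apply_left,
    Equiv.swap_apply_of_ne_of_ne (by simpa using hlt.ne)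
      (by simp only [ne_eq, Fin.ext_iff, Fin.val_castSucc, Fin.val_succ]; omega)]
  simp only [lt_irrefl, if_false, if_true, not_lt_of_gt hlt, hlt.ne', sgn_add_left, hs]
  congr 2
  have hc : b.castSucc ≠ a.castSucc := by simpa using hlt.ne'
  have hc' : b.succ ≠ a.castSucc := by
    simp only [ne_eq, Fin.ext_iff, Fin.val_castSucc, Fin.val_succ]; omega
  have hcc : b.succ ≠ b.castSucc := by simp [Fin.ext_iff]
  funext k
  by_cases hka : k = a
  · subst hka
    simp [mulAt, not_lt_of_gt hlt, hlt, hlt.ne']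
  by_cases hkb : k = b
  · subst hkb
    rw [Equiv.swap_apply_right]
    simp [mulAt, hs, Equiv.swap_apply_of_ne_of_ne hc' hcc,
      Equiv.swap_apply_of_ne_of_ne hc.symm hc'.symm]
  rw [Equiv.swap_apply_of_ne_of_ne hka hkb]
  rcases lt_or_gt_of_ne hka with h | h
  · have h' : k < b := h.trans hlt
    have n1 : k.castSucc ≠ a.castSucc := by simpa using hka
    have n2 : k.castSucc ≠ b.castSucc := by simpa using hkb
    have n3 : k.castSucc ≠ b.succ := by
      simp only [ne_eq, Fin.ext_iff, Fin.val_castSucc, Fin.val_succ, Fin.lt_def] at *; omega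
    simp only [mulAt, h, h', if_true, Equiv.Perm.mul_apply, Equiv.swap_apply_of_ne_of_ne n1 n2,
      Equiv.swap_apply_of_ne_of_ne n2 n3]
  · have h' : ¬ k < b := by
      simp only [Fin.ext_iff, Fin.lt_def] at *; omega
    have n1 : k.succ ≠ a.castSucc := by
      simp only [ne_eq, Fin.ext_iff, Fin.val_castSucc, Fin.val_succ, Fin.lt_def] at *; omega
    have n2 : k.succ ≠ b.castSucc := by
      simp only [ne_eq, Fin.ext_iff, Fin.val_castSucc, Fin.val_succ, Fin.lt_def] at *; omega
    have n3 : k.succ ≠ b.succ := by simpa using hkb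
    simp only [mulAt, not_lt_of_gt h, h', hka, hkb, if_false, Equiv.Perm.mul_apply,
      Equiv.swap_apply_of_ne_of_ne n1 n2, Equiv.swap_apply_of_ne_of_ne n2 n3]

lemma symmetrize_insertMul_symAct_swap (i : Fin N) {a b : Fin N} (hab : a.val + 1 = b.val)
    (F : MultilinearMap K (fun _ : Fin N => A) A) :
    symmetrize 𝒜 (insertMul i (symAct 𝒜 (Equiv.swap a b) F)) =
      symmetrize 𝒜 (insertMul (Equiv.swap a b i) F) := by
  by_cases ha : i = a
  · subst ha
    rw [insertMul_symAct_swap_left 𝒜 hab, symmetrize_symAct, Equiv.swap_apply_left]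
  by_cases hb : i = b
  · subst hb
    -- The previous case applied to the transposed map; the transposition is an involution.
    have h := congrArg (symmetrize 𝒜)
      (insertMul_symAct_swap_left 𝒜 hab (symAct 𝒜 (Equiv.swap a i) F))
    rw [← symAct_mul, Equiv.swap_mul_self, symAct_one, symmetrize_symAct] at h
    rw [Equiv.swap_apply_right, h]
  · obtain ⟨τ, hτ⟩ := insertMul_symAct_swap_of_ne 𝒜 i hab ha hb F
    rw [hτ, symmetrize_symAct, Equiv.swap_apply_of_ne_of_ne ha hb]

lemma symmetrize_insertMul_symAct (σ : Equiv.Perm (Fin N)) (i : Fin N)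
    (F : MultilinearMap K (fun _ : Fin N => A) A) :
    symmetrize 𝒜 (insertMul i (symAct 𝒜 σ F)) = symmetrize 𝒜 (insertMul (σ⁻¹ i) F) := by
  induction σ using perm_adjacent_induction generalizing i with
  | one => rw [symAct_one, inv_one, Equiv.Perm.one_apply]
  | swap_mul σ a b hab ih =>
    rw [symAct_mul, symmetrize_insertMul_symAct_swap 𝒜 i hab, ih, mul_inv_rev, Equiv.swap_inv,
      Equiv.Perm.mul_apply]

/-- For a symmetrized map all merging places give the same result, so one of them, taken `N` times,
is the sum over all. In that sum each translate of `F` merely permutes the places. -/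
lemma symmetrize_insertMul_symmetrize (i : Fin N)
    (F : MultilinearMap K (fun _ : Fin N => A) A) :
    (N : K) • symmetrize 𝒜 (insertMul i (symmetrize 𝒜 F)) =
      (N.factorial : K) • ∑ k, symmetrize 𝒜 (insertMul k F) := by
  have h1 : ∀ k, symmetrize 𝒜 (insertMul k (symmetrize 𝒜 F)) =
      symmetrize 𝒜 (insertMul i (symmetrize 𝒜 F)) := fun k => by
    have := symmetrize_insertMul_symAct 𝒜 (Equiv.swap i k) i (symmetrize 𝒜 F)
    rw [symAct_symmetrize, Equiv.swap_inv, Equiv.swap_apply_left] at this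
    exact this.symm
  have h2 : ∑ k, symmetrize 𝒜 (insertMul k (symmetrize 𝒜 F)) =
      (N : K) • symmetrize 𝒜 (insertMul i (symmetrize 𝒜 F)) := by
    simp only [h1]
    rw [Finset.sum_const, Finset.card_univ, Fintype.card_fin, Nat.cast_smul_eq_nsmul]
  rw [← h2]
  simp only [symmetrize_apply 𝒜 F, insertMul_sum, map_sum, symmetrize_insertMul_symAct]
  rw [Finset.sum_comm]
  have h3 : ∀ σ : Equiv.Perm (Fin N), ∑ k, symmetrize 𝒜 (insertMul (σ⁻¹ k) F) =
      ∑ k, symmetrize 𝒜 (insertMul k F) := fun σ =>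
    Equiv.sum_comp σ⁻¹ fun k => symmetrize 𝒜 (insertMul k F)
  simp only [h3]
  rw [Finset.sum_const, Finset.card_univ, Fintype.card_perm, Fintype.card_fin,
    Nat.cast_smul_eq_nsmul]

end Operations
lemma sum_ite_val_lt {M : Type*} [AddCommMonoid M] {p q N : ℕ} (h : p + q = N) (x y : M) :
    (∑ k : Fin N, if k.val < p then x else y) = p • x + q • y := by
  subst h
  rw [Fin.sum_univ_add]
  simp

/-! ### The words f(a_0⋯a_j) a_{j+1}⋯a_n and their products with `mu 𝒜 1`. -/

section Word

variable {K A : Type*} [Field K] [NonUnitalRing A] [Module K A]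
  [IsScalarTower K A A] [SMulCommClass K A A]

/-- The multilinear map `(a₀, …, a_n) ↦ f(a₀ ⋯ a_j) a_{j+1} ⋯ a_n`, where `n = l + j`. -/
def word (f : A →ₗ[K] A) (j l : ℕ) {n : ℕ} (h : l + j = n) :
    MultilinearMap K (fun _ : Fin (n + 1) => A) A :=
  insertFirst (mulMap K A l) (f.compMultilinearMap (mulMap K A j)) h

lemma word_apply (f : A →ₗ[K] A) (j l : ℕ) {n : ℕ} (h : l + j = n) (v : Fin (n + 1) → A) :
    word f j l h v = mulMap K A l (Fin.cons (f (mulMap K A j fun x => v ⟨x.val, by omega⟩))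
      (fun y : Fin l => v ⟨j + 1 + y.val, by omega⟩)) := rfl

lemma mulLast_word (f : A →ₗ[K] A) {j l n : ℕ} (h : l + j = n) :
    mulLast (word f j l h) = word f j (l + 1) (by omega : l + 1 + j = n + 1) := by
  ext v
  rw [mulLast_apply, word_apply, word_apply, mulMap_succ]
  congr 1
  · congr 1
    funext k
    refine Fin.cases ?_ (fun k => ?_) k
    · rfl
    · rw [← Fin.succ_castSucc]
      rfl
  · refine (congrArg v ?_ : v (Fin.last (n + 1)) = v ⟨j + 1 + l, by omega⟩)
    ext
    simp only [Fin.val_last]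
    omega

lemma insertMul_word_of_le (f : A →ₗ[K] A) {j l n : ℕ} (h : l + j = n) {i : Fin (n + 1)}
    (hi : i.val ≤ j) :
    insertMul i (word f j l h) = word f (j + 1) l (by omega : l + (j + 1) = n + 1) := by
  ext v
  rw [insertMul_apply, word_apply, word_apply, ← mulMap_mulAt j ⟨i.val, by omega⟩]
  congr 2
  · congr 2
    funext x
    simp only [mulAt, Fin.lt_def, Fin.ext_iff]
    rfl
  · funext y
    have h1 : ¬ j + 1 + y.val < i.val := by omega
    have h2 : ¬ j + 1 + y.val = i.val := by omega
    simp only [mulAt, Fin.lt_def, Fin.ext_iff, h1, h2, if_false]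
    congr 1
    ext
    simp only [Fin.val_succ]
    omega

lemma insertMul_word_of_lt (f : A →ₗ[K] A) {j l n : ℕ} (h : l + j = n) {i : Fin (n + 1)}
    (hi : j < i.val) :
    insertMul i (word f j l h) = word f j (l + 1) (by omega : l + 1 + j = n + 1) := by
  ext v
  -- The value of `f` takes place 0 of the outer product, so place `i` of the word is place `i - j`
  -- there.
  rw [insertMul_apply, word_apply, word_apply, ← mulMap_mulAt l ⟨i.val - j, by omega⟩]
  congr 1
  funext k
  refine Fin.cases ?_ (fun k => ?_) k
  · have h1 : 0 < i.val - j := by omega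
    simp only [Fin.cons_zero]
    simp only [mulAt, Fin.lt_def, Fin.ext_iff, Fin.val_zero, h1, if_true, Fin.castSucc_zero,
      Fin.cons_zero]
    congr 2
    funext x
    have h2 : x.val < i.val := by omega
    simp only [h2, if_true]
    rfl
  · simp only [Fin.cons_succ]
    simp only [mulAt, Fin.lt_def, Fin.ext_iff, Fin.val_succ, ← Fin.succ_castSucc, Fin.cons_succ]
    have e1 : j + 1 + k.val < i.val ↔ k.val + 1 < i.val - j := by omega
    have e2 : j + 1 + k.val = i.val ↔ k.val + 1 = i.val - j := by omega
    simp only [e1, e2]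
    rfl

variable (𝒜 : ZMod 2 → Submodule K A) [DirectSum.Decomposition 𝒜] [CommSuperalgebra 𝒜]

/-- The supersymmetric map which on homogeneous elements is the sum over `(j + 1, l)`-shuffles of
`± f(a_{σ(0)} ⋯ a_{σ(j)}) a_{σ(j+1)} ⋯ a_{σ(n)}`, where `n = l + j`. -/
def symWord (f : A →ₗ[K] A) (j l : ℕ) {n : ℕ} (h : l + j = n) : SymMap 𝒜 n :=
  wedge 𝒜 (mu 𝒜 l) ⟨f.compMultilinearMap (mulMap K A j), comp_mem 𝒜 f (mu 𝒜 j)⟩ h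

lemma symmetrize_word (f : A →ₗ[K] A) {j l n : ℕ} (h : l + j = n) :
    symmetrize 𝒜 (word f j l h) =
      (((j + 1).factorial * l.factorial : ℕ) : K) • (symWord 𝒜 f j l h).1 :=
  symmetrize_insertFirst 𝒜 (mu 𝒜 l) ⟨_, comp_mem 𝒜 f (mu 𝒜 j)⟩ h

lemma insertFirst_mulMap_one {n : ℕ} (F : MultilinearMap K (fun _ : Fin (n + 1) => A) A) :
    insertFirst (mulMap K A 1) F (add_comm 1 n) = mulLast F := by
  ext v
  rw [insertFirst_apply, mulLast_apply, mulMap_succ, mulMap_zero]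
  rfl

lemma insertFirst_mulMap_one_right {n : ℕ} (F : MultilinearMap K (fun _ : Fin (n + 1) => A) A) :
    insertFirst F (mulMap K A 1) rfl = insertMul 0 F := by
  ext v
  rw [insertFirst_apply, insertMul_apply, mulMap_succ, mulMap_zero]
  congr 1
  funext k
  refine Fin.cases ?_ (fun k => ?_) k
  · rfl
  · simp only [Fin.cons_succ, mulAt, Fin.not_lt_zero, Fin.succ_ne_zero, if_false]
    congr 1
    ext
    simp only [Fin.val_succ]
    omega

variable [CharZero K]

/-- The factor counts the `l + 1` outer entries of the new word, any of which may be the one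
multiplied in last. -/
lemma wedge_mu_one_symWord (f : A →ₗ[K] A) {j l n : ℕ} (h : l + j = n) :
    wedge 𝒜 (mu 𝒜 1) (symWord 𝒜 f j l h) (add_comm 1 n) =
      ((l : K) + 1) • symWord 𝒜 f j (l + 1) (by omega : l + 1 + j = n + 1) := by
  apply Subtype.ext
  have h1 := symmetrize_insertFirst 𝒜 (mu 𝒜 1) (symWord 𝒜 f j l h) (add_comm 1 n)
  have h2 := symmetrize_mulLast_symmetrize 𝒜 (word f j l h)
  have h3 : symmetrize 𝒜 (mulLast (symWord 𝒜 f j l h).1) =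
      (((n + 1).factorial * Nat.factorial 1 : ℕ) : K) •
        (wedge 𝒜 (mu 𝒜 1) (symWord 𝒜 f j l h) (add_comm 1 n)).1 := by
    rw [← insertFirst_mulMap_one]; exact h1
  rw [symmetrize_word, mulLast_smul, map_smul, h3, mulLast_word, symmetrize_word, smul_smul,
    smul_smul] at h2
  -- Both sides are compared after multiplication by the factorials that turn shuffle sums into full
  -- symmetrizations.
  have hn : (((j + 1).factorial * l.factorial * (n + 1).factorial : ℕ) : K) ≠ 0 :=
    Nat.cast_ne_zero.2 (by positivity)
  refine smul_right_injective _ hn ?_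
  simp only [Submodule.coe_smul, smul_smul]
  refine Eq.trans ?_ (h2.trans ?_)
  · congr 1
    push_cast [Nat.factorial_one]
    ring
  · congr 1
    push_cast [Nat.factorial_succ l]
    ring

/-- The pair multiplied first ends up either inside `f`, chosen among `j + 2` entries, or outside,
chosen among `l + 1`; hence the binomials C(j+2, 2) and C(l+1, 2). -/
lemma wedge_symWord_mu_one (f : A →ₗ[K] A) {j l n : ℕ} (h : l + j = n) :
    wedge 𝒜 (symWord 𝒜 f j l h) (mu 𝒜 1) rfl =
      ((j + 1) * (j + 2) / 2 : K) • symWord 𝒜 f (j + 1) l (by omega : l + (j + 1) = n + 1) +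
      (l * (l + 1) / 2 : K) • symWord 𝒜 f j (l + 1) (by omega : l + 1 + j = n + 1) := by
  apply Subtype.ext
  have h1 := symmetrize_insertFirst 𝒜 (symWord 𝒜 f j l h) (mu 𝒜 1) rfl
  have h2 := symmetrize_insertMul_symmetrize 𝒜 0 (word f j l h)
  have h3 : symmetrize 𝒜 (insertMul 0 (symWord 𝒜 f j l h).1) =
      ((Nat.factorial 2 * n.factorial : ℕ) : K) •
        (wedge 𝒜 (symWord 𝒜 f j l h) (mu 𝒜 1) rfl).1 := by
    rw [← insertFirst_mulMap_one_right]; exact h1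
  -- Of the `n + 1` places of the word, `j + 1` are inside `f` and `l` outside.
  have h4 : ∑ k, symmetrize 𝒜 (insertMul k (word f j l h)) =
      ((j + 1 : ℕ) : K) • symmetrize 𝒜 (word f (j + 1) l (by omega : l + (j + 1) = n + 1)) +
      (l : K) • symmetrize 𝒜 (word f j (l + 1) (by omega : l + 1 + j = n + 1)) := by
    have h5 : ∀ k : Fin (n + 1), symmetrize 𝒜 (insertMul k (word f j l h)) =
        if k.val < j + 1 then symmetrize 𝒜 (word f (j + 1) l (by omega : l + (j + 1) = n + 1))
        else symmetrize 𝒜 (word f j (l + 1) (by omega : l + 1 + j = n + 1)) := fun k => by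
      split_ifs with hk
      · rw [insertMul_word_of_le f h (by omega)]
      · rw [insertMul_word_of_lt f h (by omega)]
    rw [Finset.sum_congr rfl fun k _ => h5 k, sum_ite_val_lt (by omega : j + 1 + l = n + 1),
      Nat.cast_smul_eq_nsmul, Nat.cast_smul_eq_nsmul]
  rw [h4, symmetrize_word, insertMul_smul, map_smul, h3, symmetrize_word, symmetrize_word,
    smul_add, smul_smul, smul_smul, smul_smul, smul_smul, smul_smul, smul_smul] at h2
  have hn : ((2 * (j + 1).factorial * l.factorial * (n + 1).factorial : ℕ) : K) ≠ 0 :=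
    Nat.cast_ne_zero.2 (by positivity)
  refine smul_right_injective _ hn ?_
  simp only [Submodule.coe_smul, Submodule.coe_add, smul_add, smul_smul]
  refine Eq.trans ?_ (h2.trans ?_)
  · congr 1
    push_cast [Nat.factorial_succ n, Nat.factorial_two]
    ring
  · congr 2
    · push_cast [Nat.factorial_succ (j + 1)]
      ring
    · push_cast [Nat.factorial_succ l]
      ring

end Word

/-! ### The operators `rho` computed on coefficient vectors. -/

section Bilinear

variable {K A : Type*} [Field K] [NonUnitalRing A] [Module K A]
variable (𝒜 : ZMod 2 → Submodule K A)

lemma SymMap.sub_smul {n : ℕ} (a b : K) (F : SymMap 𝒜 n) : (a - b) • F = a • F - b • F :=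
  _root_.sub_smul a b F

lemma SymMap.smul_sub {n : ℕ} (a : K) (F G : SymMap 𝒜 n) : a • (F - G) = a • F - a • G :=
  _root_.smul_sub a F G

variable [DirectSum.Decomposition 𝒜]

lemma shuffleSum_add {N p : ℕ} (F G : MultilinearMap K (fun _ : Fin N => A) A) :
    shuffleSum 𝒜 p (F + G) = shuffleSum 𝒜 p F + shuffleSum 𝒜 p G := by
  simp only [shuffleSum_eq_sum_symAct, map_add, Finset.sum_add_distrib]

lemma shuffleSum_smul {N p : ℕ} (c : K) (F : MultilinearMap K (fun _ : Fin N => A) A) :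
    shuffleSum 𝒜 p (c • F) = c • shuffleSum 𝒜 p F := by
  simp only [shuffleSum_eq_sum_symAct, map_smul, Finset.smul_sum]

/-- The product `wedge` as a bilinear map. -/
def wedgeBilin {i j n : ℕ} (h : i + j = n) : SymMap 𝒜 i →ₗ[K] SymMap 𝒜 j →ₗ[K] SymMap 𝒜 n :=
  LinearMap.mk₂ K (fun F G => wedge 𝒜 F G h)
    (fun F F' G => Subtype.ext <|
      (congrArg (shuffleSum 𝒜 (j + 1)) (MultilinearMap.ext fun _ => rfl)).trans
        (shuffleSum_add 𝒜 (insertFirst F.1 G.1 h) (insertFirst F'.1 G.1 h)))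
    (fun c F G => Subtype.ext <|
      (congrArg (shuffleSum 𝒜 (j + 1)) (MultilinearMap.ext fun _ => rfl)).trans
        (shuffleSum_smul 𝒜 c (insertFirst F.1 G.1 h)))
    (fun F G G' => Subtype.ext <|
      (congrArg (shuffleSum 𝒜 (j + 1))
        (MultilinearMap.ext fun _ => F.1.cons_add _ _ _)).trans
        (shuffleSum_add 𝒜 (insertFirst F.1 G.1 h) (insertFirst F.1 G'.1 h)))
    (fun c F G => Subtype.ext <|
      (congrArg (shuffleSum 𝒜 (j + 1))
        (MultilinearMap.ext fun _ => F.1.cons_smul _ _ _)).trans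
        (shuffleSum_smul 𝒜 c (insertFirst F.1 G.1 h)))

lemma wedgeBilin_apply {i j n : ℕ} (h : i + j = n) (F : SymMap 𝒜 i) (G : SymMap 𝒜 j) :
    wedgeBilin 𝒜 h F G = wedge 𝒜 F G h := rfl

lemma wedge_zero_left {i j n : ℕ} (h : i + j = n) (G : SymMap 𝒜 j) :
    wedge 𝒜 (0 : SymMap 𝒜 i) G h = 0 := by
  rw [← wedgeBilin_apply, map_zero, LinearMap.zero_apply]

lemma wedge_zero_right {i j n : ℕ} (h : i + j = n) (F : SymMap 𝒜 i) :
    wedge 𝒜 F (0 : SymMap 𝒜 j) h = 0 := by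
  rw [← wedgeBilin_apply, map_zero]

lemma parityPart_apply (p : ZMod 2) {n : ℕ} (F : SymMap 𝒜 n) (ε : Fin (n + 1) → ZMod 2)
    (v : Fin (n + 1) → A) (hv : ∀ i, v i ∈ 𝒜 (ε i)) :
    (parityPart 𝒜 p F).1 v = proj 𝒜 (p + ∑ i, ε i) (F.1 v) :=
  homogExt_apply 𝒜 _ ε v hv

lemma sum_parityPart {n : ℕ} (F : SymMap 𝒜 n) : ∑ p, parityPart 𝒜 p F = F := by
  refine Subtype.ext (multilinearMap_ext_homogeneous 𝒜 fun ε v hv => ?_)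
  rw [AddSubmonoidClass.coe_finsetSum, sum_apply]
  simp only [parityPart_apply 𝒜 _ F ε v hv]
  exact (Equiv.sum_comp (Equiv.addRight (∑ i, ε i)) fun p => proj 𝒜 p (F.1 v)).trans
    (sum_proj 𝒜 _)

lemma parityPart_zero (p : ZMod 2) (n : ℕ) : parityPart 𝒜 p (0 : SymMap 𝒜 n) = 0 := by
  refine Subtype.ext (multilinearMap_ext_homogeneous 𝒜 fun ε v hv => ?_)
  rw [parityPart_apply 𝒜 p 0 ε v hv]
  simp

lemma nrBracket_zero_left {i j n : ℕ} (h : i + j = n) (G : SymMap 𝒜 j) :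
    nrBracket 𝒜 (0 : SymMap 𝒜 i) G h = 0 := by
  simp [nrBracket, wedge_zero_left, wedge_zero_right, parityPart_zero]

lemma nrBracket_zero_right {i j n : ℕ} (h : i + j = n) (F : SymMap 𝒜 i) :
    nrBracket 𝒜 F (0 : SymMap 𝒜 j) h = 0 := by
  simp [nrBracket, wedge_zero_left, wedge_zero_right, parityPart_zero]

variable [IsScalarTower K A A] [SMulCommClass K A A] [CommSuperalgebra 𝒜]

lemma mulMap_apply_mem (n : ℕ) (ε : Fin (n + 1) → ZMod 2) (v : Fin (n + 1) → A)
    (hv : ∀ i, v i ∈ 𝒜 (ε i)) : mulMap K A n v ∈ 𝒜 (∑ i, ε i) := by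
  induction n with
  | zero => simpa [mulMap_zero] using hv 0
  | succ n ih =>
    rw [mulMap_succ, Fin.sum_univ_castSucc]
    exact CommSuperalgebra.mul_mem (ih _ _ fun i => hv _) (hv _)

lemma parityPart_zero_mu (n : ℕ) : parityPart 𝒜 0 (mu 𝒜 n) = mu 𝒜 n := by
  refine Subtype.ext (multilinearMap_ext_homogeneous 𝒜 fun ε v hv => ?_)
  rw [parityPart_apply 𝒜 0 _ ε v hv, zero_add]
  exact proj_same 𝒜 (mulMap_apply_mem 𝒜 n ε v hv)

lemma parityPart_one_mu (n : ℕ) : parityPart 𝒜 1 (mu 𝒜 n) = 0 := by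
  refine Subtype.ext (multilinearMap_ext_homogeneous 𝒜 fun ε v hv => ?_)
  rw [parityPart_apply 𝒜 1 _ ε v hv]
  exact proj_ne 𝒜 (mulMap_apply_mem 𝒜 n ε v hv) (by simp)

/-- Since `mu 𝒜 m` is even, all signs in the bracket are 1, and the parity parts of `F` add up to
`F`. -/
lemma nrBracket_mu_left {m n r : ℕ} (h : m + n = r) (F : SymMap 𝒜 n) :
    nrBracket 𝒜 (mu 𝒜 m) F h =
      wedge 𝒜 (mu 𝒜 m) F h - wedge 𝒜 F (mu 𝒜 m) ((add_comm n m).trans h) := by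
  unfold nrBracket
  congr 1
  have h2 : ∀ g : ZMod 2 → SymMap 𝒜 r, ∑ p, g p = g 0 + g 1 := fun g =>
    Fin.sum_univ_two (f := g)
  rw [h2]
  have hs : ∀ q : ZMod 2, sgn K 0 q = 1 := fun q => by simp [sgn]
  simp only [parityPart_zero_mu, parityPart_one_mu, wedge_zero_right, smul_zero,
    Finset.sum_const_zero, add_zero, hs, one_smul]
  conv_rhs => rw [← sum_parityPart 𝒜 F]
  simp only [← wedgeBilin_apply, map_sum, LinearMap.sum_apply]

lemma rho_single {m n r : ℕ} (h : m + n = r) (F : SymMap 𝒜 n) :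
    rho 𝒜 m (Pi.single n F) = Pi.single r
      (wedge 𝒜 (mu 𝒜 m) F h - wedge 𝒜 F (mu 𝒜 m) ((add_comm n m).trans h)) := by
  subst h
  funext s
  have hz : ∀ i : Fin (s + 1), i.val ≠ m → nrBracket 𝒜 ((Pi.single m (mu 𝒜 m) : D 𝒜) i)
      ((Pi.single n F : D 𝒜) (s - i)) (Nat.add_sub_cancel' (Nat.le_of_lt_succ i.2)) = 0 :=
    fun i hi => by rw [Pi.single_eq_of_ne hi, nrBracket_zero_left]
  by_cases hs : s = m + n
  · subst hs
    rw [Pi.single_eq_same, ← nrBracket_mu_left 𝒜 rfl]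
    -- The degree `m + n - m` equals `n` only propositionally, and the type depends on it; hence the
    -- general `k`.
    have hk : ∀ (k : ℕ) (hk : k = n) (h : m + k = m + n), nrBracket 𝒜 (mu 𝒜 m)
        ((Pi.single n F : D 𝒜) k) h = nrBracket 𝒜 (mu 𝒜 m) F rfl := by
      rintro k rfl h
      rw [Pi.single_eq_same]
    refine (Finset.sum_eq_single (⟨m, by omega⟩ : Fin (m + n + 1)) (fun i _ hi => hz i ?_)
      (fun hi => absurd (Finset.mem_univ _) hi)).trans ?_
    · simpa [Fin.ext_iff] using hi
    · dsimp only
      rw [Pi.single_eq_same, hk _ (by omega)]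
  · rw [Pi.single_eq_of_ne hs]
    refine Finset.sum_eq_zero (s := Finset.univ) fun (i : Fin (s + 1)) _ => ?_
    by_cases hi : i.val = m
    · rw [Pi.single_eq_of_ne (i := n) (i' := s - i.val) (by omega), nrBracket_zero_right]
    · exact hz i hi

lemma wedge_mu_ofLinear (f : A →ₗ[K] A) (m : ℕ) :
    wedge 𝒜 (mu 𝒜 m) (ofLinear 𝒜 f) (add_zero m) = symWord 𝒜 f 0 m (add_zero m) := rfl

lemma wedge_ofLinear_mu (f : A →ₗ[K] A) (m : ℕ) :
    wedge 𝒜 (ofLinear 𝒜 f) (mu 𝒜 m) (zero_add m) = symWord 𝒜 f m 0 (zero_add m) := rfl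

/-- The combination of the maps `symWord 𝒜 f j (n - j)`, `j ≤ n`, with rational coefficients
`x j`. -/
def symWordComb (f : A →ₗ[K] A) (n : ℕ) (x : ℕ → ℚ) : SymMap 𝒜 n :=
  ∑ j : Fin (n + 1), (x j : K) •
    symWord 𝒜 f j (n - j) (Nat.sub_add_cancel (Nat.le_of_lt_succ j.2))

/-- The action of `ρ₁` on coefficients. -/
def rhoCoeff (n : ℕ) (x : ℕ → ℚ) (j : ℕ) : ℚ :=
  ((n : ℚ) + 1 - j) * (2 - n + j) / 2 * x j - (j : ℚ) * (j + 1) / 2 * x (j - 1)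

/-- The coefficients of `ρ₁ᵏ ρ_i f`. -/
def iterCoeff (i : ℕ) : ℕ → ℕ → ℚ
  | 0 => fun j => (if j = 0 then 1 else 0) - if j = i then 1 else 0
  | k + 1 => rhoCoeff (i + k) (iterCoeff i k)

lemma symWordComb_sub [CharZero K] (f : A →ₗ[K] A) (n : ℕ) (x y : ℕ → ℚ) :
    symWordComb 𝒜 f n (fun j => x j - y j) = symWordComb 𝒜 f n x - symWordComb 𝒜 f n y := by
  simp only [symWordComb, Rat.cast_sub, SymMap.sub_smul, Finset.sum_sub_distrib]

lemma antibracket_eq_symWordComb (f : A →ₗ[K] A) (n : ℕ) :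
    antibracket 𝒜 f n = symWordComb 𝒜 f n fun j => (-1) ^ (n - j) := by
  unfold antibracket symWordComb
  refine Finset.sum_congr rfl fun j _ => ?_
  push_cast
  rfl

variable [CharZero K]

lemma rho_one_symWordComb (f : A →ₗ[K] A) (n : ℕ) (x : ℕ → ℚ) :
    rho 𝒜 1 (Pi.single n (symWordComb 𝒜 f n x)) =
      Pi.single (n + 1) (symWordComb 𝒜 f (n + 1) (rhoCoeff n x)) := by
  rw [rho_single 𝒜 (add_comm 1 n)]
  congr 1
  have hl : ∀ (j : ℕ) {l l' : ℕ} (e : l = l') (h : l + j = n + 1),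
      symWord 𝒜 f j l h = symWord 𝒜 f j l' (e ▸ h) := by
    rintro j l _ rfl h
    rfl
  have h1 : symWordComb 𝒜 f (n + 1) (rhoCoeff n x) =
      ∑ j : Fin (n + 1), (x j : K) • (((n : K) + 1 - j) * (2 - n + j) / 2) •
        symWord 𝒜 f j (n - j + 1) (by omega : n - j + 1 + j = n + 1) -
      ∑ j : Fin (n + 1), (x j : K) • (((j : K) + 1) * (j + 2) / 2) •
        symWord 𝒜 f (j + 1) (n - j) (by omega : n - j + (j + 1) = n + 1) := by
    simp only [symWordComb, rhoCoeff, Rat.cast_sub, SymMap.sub_smul, Finset.sum_sub_distrib]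
    congr 1
    -- The term `j = n + 1` carries the factor `n + 1 - j = 0`, so the value `x (n + 1)` is
    -- irrelevant.
    · rw [Fin.sum_univ_castSucc]
      simp only [Fin.val_last]
      push_cast
      rw [sub_self, zero_mul, zero_div, zero_mul, zero_smul, add_zero]
      refine Finset.sum_congr rfl fun j _ => ?_
      have hj : n + 1 - j.val = n - j.val + 1 := by omega
      rw [smul_smul, mul_comm (x j : K)]
      congr 1
      exact hl _ hj _
    -- The term `j = 0` carries the factor `j`, so the truncated index `j - 1` does no harm there.
    · rw [Fin.sum_univ_succ]
      simp only [Fin.val_zero, Fin.val_succ]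
      push_cast
      rw [zero_mul, zero_div, zero_mul, zero_smul, zero_add]
      refine Finset.sum_congr rfl fun j _ => ?_
      rw [smul_smul, mul_comm (x j : K),
        show (j.val : K) + 1 + 1 = j.val + 2 by ring]
  rw [h1]
  simp only [symWordComb, ← wedgeBilin_apply, map_sum, map_smul, LinearMap.sum_apply,
    LinearMap.smul_apply]
  simp only [wedgeBilin_apply, wedge_mu_one_symWord, wedge_symWord_mu_one]
  rw [← Finset.sum_sub_distrib, ← Finset.sum_sub_distrib]
  refine Finset.sum_congr rfl fun j _ => ?_
  rw [← SymMap.smul_sub, ← SymMap.smul_sub]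
  congr 1
  rw [sub_add_eq_sub_sub_swap, ← SymMap.sub_smul, Nat.cast_sub (Nat.le_of_lt_succ j.2)]
  congr 2
  ring

/-- At the start, ρ_i f is the difference of the two extreme words; each `rho 𝒜 1` then acts through
`rhoCoeff`. -/
lemma iterate_rho (f : A →ₗ[K] A) {i k n : ℕ} (h : i + k = n) :
    (rho 𝒜 1)^[k] (rho 𝒜 i (Pi.single 0 (ofLinear 𝒜 f))) =
      Pi.single n (symWordComb 𝒜 f n (iterCoeff i k)) := by
  subst h
  induction k with
  | zero =>
    rw [Function.iterate_zero, id, rho_single 𝒜 (add_zero i), wedge_mu_ofLinear,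
      wedge_ofLinear_mu]
    congr 1
    simp only [symWordComb, iterCoeff, Rat.cast_sub, SymMap.sub_smul, Finset.sum_sub_distrib]
    congr 1
    · rw [Finset.sum_eq_single 0]
      · simp
      · intro j _ hj
        rw [if_neg (fun h0 : j.val = 0 => hj (Fin.ext h0)), Rat.cast_zero, zero_smul]
      · simp
    · rw [Finset.sum_eq_single (Fin.last i)]
      · simp only [Fin.val_last, if_true, Rat.cast_one, one_smul]
        have hl : ∀ (l : ℕ) (e : 0 = l) (h : l + i = i),
            symWord 𝒜 f i 0 (zero_add i) = symWord 𝒜 f i l h := by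
          rintro _ rfl h
          rfl
        exact hl _ (by omega) _
      · intro j _ hj
        rw [if_neg (fun h0 : j.val = i => hj (Fin.ext h0)), Rat.cast_zero, zero_smul]
      · simp
  | succ k ih =>
    rw [Function.iterate_succ_apply', ih, rho_one_symWordComb]
    rfl

end Bilinear

/-! ### Linear algebra of the rational coefficient vectors. -/

section Coefficients

/-- The combination of the coefficients of `ρ₁ⁿ⁻ⁱ ρ_i f`, `1 ≤ i ≤ n`. -/
def iterComb (n : ℕ) (c : ℕ → ℚ) (j : ℕ) : ℚ :=
  ∑ i ∈ Finset.range n, c i * iterCoeff (i + 1) (n - (i + 1)) j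

/-- In degree `n + 1` every vector but the last is `rhoCoeff` of one from degree `n`; the last is
that of ρ_{n+1} f. -/
lemma iterComb_succ (n : ℕ) (c : ℕ → ℚ) (j : ℕ) :
    iterComb (n + 1) c j = rhoCoeff n (iterComb n c) j +
      c n * ((if j = 0 then 1 else 0) - if j = n + 1 then 1 else 0) := by
  have h : ∀ i ∈ Finset.range n, c i * iterCoeff (i + 1) (n + 1 - (i + 1)) j =
      c i * rhoCoeff n (iterCoeff (i + 1) (n - (i + 1))) j := fun i hi => by
    have hi' := Finset.mem_range.1 hi
    rw [show n + 1 - (i + 1) = n - (i + 1) + 1 by omega, iterCoeff,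
      show i + 1 + (n - (i + 1)) = n by omega]
  rw [iterComb, Finset.sum_range_succ, Finset.sum_congr rfl h, Nat.sub_self, iterCoeff]
  congr 1
  simp only [rhoCoeff, iterComb, Finset.mul_sum, ← Finset.sum_sub_distrib]
  exact Finset.sum_congr rfl fun i _ => by ring

/-- The matrix is lower bidiagonal with nonzero subdiagonal, so the equations solve downwards from
row `n + 1`, where only `x n` occurs. -/
lemma rhoCoeff_injective {n : ℕ} {x : ℕ → ℚ} (h : ∀ j ≤ n + 1, rhoCoeff n x j = 0) :
    ∀ j ≤ n, x j = 0 := by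
  intro j hj
  induction hk : n - j generalizing j with
  | zero =>
    obtain rfl : j = n := by omega
    have := h (j + 1) le_rfl
    simp only [rhoCoeff, Nat.add_sub_cancel] at this
    push_cast at this
    have h2 : ((j : ℚ) + 1) * (j + 1 + 1) / 2 ≠ 0 := by positivity
    have h3 : ((j : ℚ) + 1) * (j + 1 + 1) / 2 * x j = 0 := by linear_combination -this
    exact (mul_eq_zero.1 h3).resolve_left h2
  | succ k ih =>
    have h1 := ih (j + 1) (by omega) (by omega)
    have := h (j + 1) (by omega)
    simp only [rhoCoeff, Nat.add_sub_cancel, h1] at this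
    push_cast at this
    have h2 : ((j : ℚ) + 1) * (j + 1 + 1) / 2 ≠ 0 := by positivity
    have h3 : ((j : ℚ) + 1) * (j + 1 + 1) / 2 * x j = 0 := by linear_combination -this
    exact (mul_eq_zero.1 h3).resolve_left h2

/-- The coefficients of `ρ_{n+1} f` are not in the image of `ρ₁`. -/
lemma eq_zero_of_rhoCoeff_eq {n : ℕ} (hn : 0 < n) {x : ℕ → ℚ} {c : ℚ}
    (h : ∀ j ≤ n + 1, rhoCoeff n x j = c * ((if j = 0 then 1 else 0) -
      if j = n + 1 then 1 else 0)) : c = 0 := by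
  -- For `n = 1` the three rows read x_0 = c, x_1 = x_0 and 3 x_1 = c. For `n = 0` the claim would
  -- fail.
  rcases (by omega : n = 1 ∨ 2 ≤ n) with rfl | hn2
  · have h0 := h 0 (by omega)
    have h1 := h 1 (by omega)
    have h2 := h 2 (by omega)
    norm_num [rhoCoeff] at h0 h1 h2
    linarith
  · obtain ⟨m, rfl⟩ := Nat.exists_eq_add_of_le' hn2
    have hmid : ∀ j, j < m + 2 → rhoCoeff (m + 2) x (j + 1) = 0 := fun j hj => by
      rw [h (j + 1) (by omega), if_neg (by omega), if_neg (by omega)]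
      ring
    -- The diagonal coefficient vanishes in row `m = n - 2`, so that row kills `x (m - 1)`, and the
    -- rows above it kill the earlier entries in turn, down to `x 0`. Row 0 then gives `c = 0`.
    have hx : ∀ k, k < m → x (m - 1 - k) = 0 := by
      intro k hk
      induction k with
      | zero =>
        have := hmid (m - 1) (by omega)
        simp only [rhoCoeff, Nat.add_sub_cancel] at this
        have e : ((m - 1 : ℕ) : ℚ) = m - 1 := by rw [Nat.cast_sub (by omega)]; simp
        push_cast [e] at this
        have hm : (0 : ℚ) < m := by exact_mod_cast hk
        have h2 : (m : ℚ) * (m + 1) / 2 ≠ 0 := by positivity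
        have h3 : (m : ℚ) * (m + 1) / 2 * x (m - 1) = 0 := by linear_combination -this
        exact (mul_eq_zero.1 h3).resolve_left h2
      | succ k ih =>
        have h1 := ih (by omega)
        have := hmid (m - 1 - (k + 1)) (by omega)
        rw [show m - 1 - (k + 1) + 1 = m - 1 - k by omega] at this
        simp only [rhoCoeff, h1, mul_zero, zero_sub, neg_eq_zero,
          show m - 1 - k - 1 = m - 1 - (k + 1) by omega] at this
        have hm : (0 : ℚ) < ((m - 1 - k : ℕ) : ℚ) := by
          exact_mod_cast (by omega : 0 < m - 1 - k)
        exact (mul_eq_zero.1 this).resolve_left (by positivity)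
    have h0 := h 0 (by omega)
    simp only [rhoCoeff, if_true, if_neg (show ¬ 0 = m + 2 + 1 by omega)] at h0
    push_cast at h0
    rcases Nat.eq_zero_or_pos m with rfl | hm
    · simp at h0
      exact h0.symm
    · have := hx (m - 1) (by omega)
      rw [Nat.sub_self] at this
      rw [this] at h0
      linarith

/-- The top coefficient vanishes because its vector is not in the image of `rhoCoeff`; injectivity
of `rhoCoeff` reduces the rest to degree `n`. -/
lemma iterComb_injective {n : ℕ} (hn : 0 < n) {c : ℕ → ℚ} (h : ∀ j ≤ n, iterComb n c j = 0) :
    ∀ i < n, c i = 0 := by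
  induction n, hn using Nat.le_induction with
  | base =>
    intro i hi
    have := h 0 (by omega)
    obtain rfl : i = 0 := by omega
    simpa [iterComb, iterCoeff] using this
  | succ n hn ih =>
    have hc : c n = 0 := by
      refine neg_eq_zero.1 (eq_zero_of_rhoCoeff_eq hn (x := iterComb n c) fun j hj => ?_)
      have := h j hj
      rw [iterComb_succ] at this
      linear_combination this
    intro i hi
    rcases (by omega : i = n ∨ i < n) with rfl | hi
    · exact hc
    · refine ih (rhoCoeff_injective fun j hj => ?_) i hi
      have := h j hj
      rwa [iterComb_succ, hc, zero_mul, add_zero] at this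

/-- The value on a derivation: the functional `x ↦ ∑_j C(n, j) x_j`. -/
def derivEval (n : ℕ) (x : ℕ → ℚ) : ℚ := ∑ j ∈ Finset.range (n + 1), (n.choose j : ℚ) * x j

/-- By absorption both binomials become (n+1) C(n,j), and the remaining factors (2-n+j)/2 and
(j+2)/2 differ by -n/2, whatever j is. -/
lemma derivEval_rhoCoeff (n : ℕ) (x : ℕ → ℚ) :
    derivEval (n + 1) (rhoCoeff n x) = -((n : ℚ) * (n + 1) / 2) * derivEval n x := by
  unfold derivEval rhoCoeff
  simp only [mul_sub, Finset.sum_sub_distrib]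
  rw [Finset.sum_range_succ _ (n + 1), Finset.sum_range_succ' _ (n + 1)]
  push_cast
  rw [sub_self, zero_mul, zero_div, zero_mul, mul_zero, add_zero, zero_mul, zero_div, zero_mul,
    mul_zero, add_zero, ← Finset.sum_sub_distrib, Finset.mul_sum]
  refine Finset.sum_congr rfl fun j hj => ?_
  have hj' : j ≤ n := Nat.le_of_lt_succ (Finset.mem_range.1 hj)
  have h1 : ((n + 1).choose j : ℚ) * (n + 1 - j) = (n + 1) * n.choose j := by
    have h2 := Nat.choose_mul_succ_eq n j
    have h3 : ((n + 1 - j : ℕ) : ℚ) = n + 1 - j := by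
      rw [Nat.cast_sub (by omega)]; push_cast; ring
    rw [← h3]
    have : (n.choose j : ℚ) * (n + 1) = (n + 1).choose j * ((n + 1 - j : ℕ) : ℚ) := by
      exact_mod_cast h2
    linarith
  have h2 : ((n + 1).choose (j + 1) : ℚ) * (j + 1) = (n + 1) * n.choose j := by
    have := Nat.add_one_mul_choose_eq n j
    have : ((n : ℚ) + 1) * n.choose j = (n + 1).choose (j + 1) * (j + 1) := by
      exact_mod_cast this
    linarith
  linear_combination ((2 - n + j) / 2 * x j) * h1 - ((j + 2) / 2 * x j) * h2

lemma derivEval_iterCoeff {i : ℕ} (k : ℕ) : derivEval (i + k) (iterCoeff i k) = 0 := by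
  induction k with
  | zero =>
    simp only [derivEval, iterCoeff, add_zero, mul_sub, Finset.sum_sub_distrib, mul_ite, mul_one,
      mul_zero, Finset.sum_ite_eq', Finset.mem_range]
    simp
  | succ k ih =>
    rw [← add_assoc, iterCoeff, derivEval_rhoCoeff, ih, mul_zero]

lemma derivEval_alternating {n : ℕ} (hn : 0 < n) :
    derivEval n (fun j => (-1) ^ (n - j)) = 0 := by
  have := add_pow (1 : ℚ) (-1) n
  rw [add_neg_cancel, zero_pow hn.ne'] at this
  rw [this, derivEval]
  exact Finset.sum_congr rfl fun j _ => by ring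

/-- `n` independent vectors in the kernel of a nonzero functional on ℚ^{n+1} form a basis of that
kernel. -/
lemma exists_iterComb_eq {n : ℕ} (hn : 0 < n) {x : ℕ → ℚ} (hx : derivEval n x = 0) :
    ∃ c : Fin n → ℚ, ∀ j ≤ n,
      ∑ i : Fin n, c i * iterCoeff (i.val + 1) (n - (i.val + 1)) j = x j := by
  let Λ : (Fin (n + 1) → ℚ) →ₗ[ℚ] ℚ := ∑ j : Fin (n + 1), (n.choose j : ℚ) • LinearMap.proj j
  have hΛ : ∀ y : ℕ → ℚ, Λ (fun j => y j) = derivEval n y := fun y => by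
    simp only [Λ, LinearMap.sum_apply, LinearMap.smul_apply, LinearMap.proj_apply, smul_eq_mul,
      derivEval]
    exact Fin.sum_univ_eq_sum_range (fun j => (n.choose j : ℚ) * y j) (n + 1)
  let t : Fin n → LinearMap.ker Λ := fun i =>
    ⟨fun j => iterCoeff (i.val + 1) (n - (i.val + 1)) j, by
      rw [LinearMap.mem_ker, hΛ]
      have := derivEval_iterCoeff (i := i.val + 1) (n - (i.val + 1))
      rwa [show i.val + 1 + (n - (i.val + 1)) = n by omega] at this⟩
  have hli : LinearIndependent ℚ t := by
    rw [Fintype.linearIndependent_iff]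
    intro g hg i
    let c : ℕ → ℚ := fun k => if h : k < n then g ⟨k, h⟩ else 0
    have hc : ∀ i : Fin n, c i = g i := fun i => by simp [c]
    rw [← hc]
    refine iterComb_injective hn (fun j hj => ?_) i i.2
    have := congrFun (congrArg Subtype.val hg) ⟨j, by omega⟩
    rw [AddSubmonoidClass.coe_finsetSum, Finset.sum_apply] at this
    rw [iterComb, ← Fin.sum_univ_eq_sum_range
      (fun i => c i * iterCoeff (i + 1) (n - (i + 1)) j) n]
    simp only [hc]
    exact this
  have hfin : Module.finrank ℚ (LinearMap.ker Λ) = n := by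
    have h1 := LinearMap.finrank_range_add_finrank_ker Λ
    have h2 : Function.Surjective Λ := by
      refine LinearMap.surjective fun h0 => ?_
      -- The functional is nonzero because it takes the value C(n,0) = 1 on the first basis vector.
      have := hΛ fun j => if j = 0 then 1 else 0
      rw [h0, LinearMap.zero_apply] at this
      simp [derivEval] at this
    rw [LinearMap.range_eq_top.2 h2, finrank_top, Module.finrank_self, Module.finrank_fin_fun]
      at h1
    omega
  have : Nonempty (Fin n) := ⟨⟨0, hn⟩⟩
  have hspan := hli.span_eq_top_of_card_eq_finrank (by rw [Fintype.card_fin, hfin])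
  have hmem : (⟨fun j => x j, by rw [LinearMap.mem_ker, hΛ, hx]⟩ : LinearMap.ker Λ) ∈
      Submodule.span ℚ (Set.range t) := by rw [hspan]; trivial
  obtain ⟨c, hc⟩ := (Submodule.mem_span_range_iff_exists_fun ℚ).1 hmem
  refine ⟨c, fun j hj => ?_⟩
  have := congrFun (congrArg Subtype.val hc) ⟨j, by omega⟩
  rw [AddSubmonoidClass.coe_finsetSum, Finset.sum_apply] at this
  exact this

end Coefficients

/-! ### Purely even algebras and evaluation on the diagonal. -/

section Uniqueness

/-- The grading for which all elements are even. -/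
def evenGrading (K A : Type*) [Field K] [NonUnitalRing A] [Module K A] (p : ZMod 2) :
    Submodule K A :=
  if p = 0 then ⊤ else ⊥

lemma mem_evenGrading_zero (K : Type*) {A : Type*} [Field K] [NonUnitalRing A] [Module K A]
    (a : A) : a ∈ evenGrading K A 0 := by
  simp [evenGrading]

lemma eq_zero_of_mem_evenGrading {K A : Type*} [Field K] [NonUnitalRing A] [Module K A]
    {p : ZMod 2} (hp : p ≠ 0) {a : A} (ha : a ∈ evenGrading K A p) : a = 0 := by
  simpa [evenGrading, hp] using ha

instance (K A : Type*) [Field K] [NonUnitalRing A] [Module K A] :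
    DirectSum.Decomposition (evenGrading K A) :=
  DirectSum.Decomposition.ofLinearMap _
    ((DirectSum.lof K (ZMod 2) (fun p => evenGrading K A p) 0).comp
      (LinearMap.id.codRestrict _ (mem_evenGrading_zero K)))
    (by ext a; simp)
    (by
      ext p ⟨a, ha⟩ : 2
      by_cases hp : p = 0
      · subst hp
        simp only [LinearMap.comp_apply, DirectSum.coeLinearMap_lof, LinearMap.id_apply]
        rfl
      · have h0 : (⟨a, ha⟩ : evenGrading K A p) = 0 :=
          Subtype.ext (eq_zero_of_mem_evenGrading hp ha)
        rw [h0, map_zero, map_zero])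

variable {K A : Type*} [Field K] [CommRing A] [Algebra K A]

instance : CommSuperalgebra (evenGrading K A) where
  mul_mem {p q a b} ha hb := by
    by_cases hp : p = 0
    · by_cases hq : q = 0
      · subst hp hq
        exact mem_evenGrading_zero K _
      · rw [eq_zero_of_mem_evenGrading hq hb, mul_zero]
        exact Submodule.zero_mem _
    · rw [eq_zero_of_mem_evenGrading hp ha, zero_mul]
      exact Submodule.zero_mem _
  mul_comm {p q a b} ha hb := by
    by_cases hp : p = 0
    · subst hp
      simp [sgn, mul_comm a b]
    · simp [eq_zero_of_mem_evenGrading hp ha]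

lemma mulMap_cons_const (n : ℕ) (a b : A) :
    mulMap K A n (Fin.cons b fun _ => a) = b * a ^ n := by
  induction n with
  | zero => simp [mulMap_zero]
  | succ n ih =>
    rw [mulMap_succ, pow_succ, ← mul_assoc, ← ih]
    congr 2
    funext k
    exact Fin.cases rfl (fun _ => rfl) k

lemma mulMap_const (n : ℕ) (a : A) : mulMap K A n (fun _ => a) = a ^ (n + 1) := by
  rw [pow_succ', ← mulMap_cons_const (K := K)]
  congr 1
  funext k
  exact Fin.cases rfl (fun _ => rfl) k

/-- With equal even arguments every shuffle contributes the same term with sign 1. Only the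
positivity of their number matters later. -/
lemma symWord_const (f : A →ₗ[K] A) {j l n : ℕ} (h : l + j = n) (a : A) :
    (symWord (evenGrading K A) f j l h).1 (fun _ => a) =
      (shuffles (n + 1) (j + 1)).card • (f (a ^ (j + 1)) * a ^ l) := by
  refine (shuffleSum_apply _ (j + 1) (word f j l h) (fun _ => 0) (fun _ => a)
    fun _ => mem_evenGrading_zero K a).trans ?_
  simp only [koszulSign_of_even, one_smul, word_apply, mulMap_const, mulMap_cons_const]
  rw [Finset.sum_const]

lemma card_shuffles_pos (N p : ℕ) : 0 < (shuffles N p).card :=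
  Finset.card_pos.2 ⟨1, by simp +contextual [shuffles]⟩

/-- The maps `symWord f j (n - j)` are linearly independent for polynomial algebras. -/
lemma eq_zero_of_symWordComb_eq_zero [CharZero K] {n : ℕ} {x : ℕ → ℚ} {a : A}
    (ha : ∀ l : ℕ, a ^ l ≠ 0) {k : ℕ} (hk : k ≤ n) {f : A →ₗ[K] A} (hf : f (a ^ (k + 1)) = 1)
    (hf' : ∀ m, m ≠ k + 1 → f (a ^ m) = 0)
    (hx : symWordComb (evenGrading K A) f n x = 0) : x k = 0 := by
  have h := congrArg (fun F => F.1 fun _ => a) hx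
  simp only [symWordComb, AddSubmonoidClass.coe_finsetSum, sum_apply, Submodule.coe_smul,
    smul_apply, symWord_const] at h
  -- Since `f` kills every power of `a` except the one with exponent `k + 1`, only the summand `j =
  -- k` survives.
  rw [Finset.sum_eq_single (⟨k, Nat.lt_succ_of_le hk⟩ : Fin (n + 1))] at h
  · simp only [hf, one_mul, ← Nat.cast_smul_eq_nsmul K, smul_smul] at h
    have h2 := (smul_eq_zero.1 h).resolve_right (ha _)
    have h3 := (mul_eq_zero.1 h2).resolve_right
      (Nat.cast_ne_zero.2 (card_shuffles_pos _ _).ne')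
    exact_mod_cast h3
  · intro j _ hj
    rw [hf' _ fun e => hj (Fin.ext (by simpa using e))]
    simp
  · intro hne
    exact absurd (Finset.mem_univ _) hne

end Uniqueness

/-! ### Passage from coefficient vectors to the theorem. -/

lemma sum_iterate_rho {K A : Type*} [Field K] [CharZero K] [NonUnitalRing A] [Module K A]
    [IsScalarTower K A A] [SMulCommClass K A A] (𝒜 : ZMod 2 → Submodule K A)
    [DirectSum.Decomposition 𝒜] [CommSuperalgebra 𝒜] (f : A →ₗ[K] A) (n : ℕ) (c : Fin n → ℚ) :
    ∑ i : Fin n, (c i : K) •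
        (rho 𝒜 1)^[n - (i.val + 1)] (rho 𝒜 (i.val + 1) (Pi.single 0 (ofLinear 𝒜 f))) =
      (Pi.single n (symWordComb 𝒜 f n fun j =>
        ∑ i : Fin n, c i * iterCoeff (i.val + 1) (n - (i.val + 1)) j) : D 𝒜) := by
  have h : ∀ i : Fin n, (c i : K) •
      (rho 𝒜 1)^[n - (i.val + 1)] (rho 𝒜 (i.val + 1) (Pi.single 0 (ofLinear 𝒜 f))) =
      (LinearMap.single K (fun n => SymMap 𝒜 n) n)
        ((c i : K) • symWordComb 𝒜 f n (iterCoeff (i.val + 1) (n - (i.val + 1)))) := fun i => by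
    rw [iterate_rho 𝒜 f (by omega : i.val + 1 + (n - (i.val + 1)) = n), map_smul]
    rfl
  rw [Finset.sum_congr rfl fun i _ => h i, ← map_sum]
  refine congrArg (Pi.single n) ?_
  simp only [symWordComb, Finset.smul_sum, Rat.cast_sum, Rat.cast_mul, smul_smul, Finset.sum_smul]
  exact Finset.sum_comm

end HigherAntibrackets

theorem theorem2p3 (n : ℕ) (hn : 0 < n) :
    ∃ c : Fin n → ℚ,
      ∀ (K : Type u) [Field K] [CharZero K],
        (∀ (A : Type (max u v)) [NonUnitalRing A] [Module K A] [IsScalarTower K A A]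
            [SMulCommClass K A A] (𝒜 : ZMod 2 → Submodule K A) [DirectSum.Decomposition 𝒜]
            [CommSuperalgebra 𝒜] (f : A →ₗ[K] A),
          (Pi.single n (antibracket 𝒜 f n) : D 𝒜) =
            ∑ i : Fin n, (c i : K) •
              (rho 𝒜 1)^[n - (i.val + 1)] (rho 𝒜 (i.val + 1) (Pi.single 0 (ofLinear 𝒜 f)))) ∧
        ∀ c' : Fin n → ℚ,
          (∀ (A : Type (max u v)) [NonUnitalRing A] [Module K A] [IsScalarTower K A A]
              [SMulCommClass K A A] (𝒜 : ZMod 2 → Submodule K A) [DirectSum.Decomposition 𝒜]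
              [CommSuperalgebra 𝒜] (f : A →ₗ[K] A),
            (Pi.single n (antibracket 𝒜 f n) : D 𝒜) =
              ∑ i : Fin n, (c' i : K) •
                (rho 𝒜 1)^[n - (i.val + 1)] (rho 𝒜 (i.val + 1) (Pi.single 0 (ofLinear 𝒜 f)))) →
          c' = c := by
  obtain ⟨c, hc⟩ := exists_iterComb_eq hn (derivEval_alternating hn)
  refine ⟨c, fun K _ _ => ⟨?_, fun c' hc' => ?_⟩⟩
  · intro A _ _ _ _ 𝒜 _ _ f
    rw [sum_iterate_rho, antibracket_eq_symWordComb]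
    exact congrArg (Pi.single n)
      (Finset.sum_congr rfl fun j _ => by simp only [hc j (Nat.le_of_lt_succ j.2)])
  · have key : ∀ k ≤ n,
        ∑ i : Fin n, c' i * iterCoeff (i.val + 1) (n - (i.val + 1)) k = (-1) ^ (n - k) := by
      intro k hk
      -- The polynomial algebra is lifted to the universe over which the algebras range; `f` sends a
      -- polynomial to its coefficient at X^{k+1}, viewed as a constant.
      let e : ULift.{v} (Polynomial K) ≃ₗ[K] Polynomial K := ULift.moduleEquiv
      let f : ULift.{v} (Polynomial K) →ₗ[K] ULift.{v} (Polynomial K) :=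
        e.symm.toLinearMap ∘ₗ Polynomial.monomial 0 ∘ₗ Polynomial.lcoeff K (k + 1) ∘ₗ
          e.toLinearMap
      have hf : ∀ m, f (ULift.up Polynomial.X ^ m) = if m = k + 1 then 1 else 0 := fun m => by
        have : f (ULift.up Polynomial.X ^ m) =
            ULift.up (Polynomial.monomial 0 (((Polynomial.X : Polynomial K) ^ m).coeff (k + 1))) :=
          rfl
        rw [this, Polynomial.coeff_X_pow]
        split_ifs <;> first | omega | (simp; rfl)
      have h := hc' _ (evenGrading K (ULift.{v} (Polynomial K))) f
      rw [sum_iterate_rho, antibracket_eq_symWordComb] at h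
      have h' := Pi.single_injective n h
      rw [← sub_eq_zero]
      refine eq_zero_of_symWordComb_eq_zero (K := K) (n := n)
        (x := fun k => ∑ i : Fin n, c' i * iterCoeff (i.val + 1) (n - (i.val + 1)) k -
          (-1) ^ (n - k))
        (a := (ULift.up Polynomial.X : ULift.{v} (Polynomial K))) (fun l => ?_) hk
        (f := f) (by rw [hf, if_pos rfl]) (fun m hm => by rw [hf, if_neg hm]) ?_
      · intro h0
        exact pow_ne_zero l Polynomial.X_ne_zero (congrArg ULift.down h0)
      · rw [symWordComb_sub, ← h']
        exact sub_self (symWordComb (evenGrading K (ULift.{v} (Polynomial K))) f n _)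
    funext i
    refine sub_eq_zero.1 ?_
    -- By `key` and `hc` both sequences yield the alternating vector, so their difference yields
    -- zero and vanishes by independence.
    let d : ℕ → ℚ := fun k => if h : k < n then c' ⟨k, h⟩ - c ⟨k, h⟩ else 0
    have hd : ∀ i : Fin n, d i = c' i - c i := fun i => by simp [d]
    rw [← hd]
    refine iterComb_injective hn (fun j hj => ?_) i i.2
    rw [iterComb, ← Fin.sum_univ_eq_sum_range
      (fun i => d i * iterCoeff (i + 1) (n - (i + 1)) j) n]
    simp only [hd, sub_mul, Finset.sum_sub_distrib]
    rw [key j hj, hc j hj, sub_self]
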